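/- Let $\Sigma$ be a connected oriented surface of genus $g>0$ with $s\ge 1$ punctures $v_1,\dots,v_s$, and let $\lambda$ be an ideal triangulation of $\Sigma$ with edges $\lambda_1,\dots,\lambda_n$ and faces $T_1,\dots,T_m$, i.e. a gluing of $m$ oriented triangles along their sides whose vertices are exactly the punctures (two sides of the same triangle may be glued together). Let $N\ge 1$ be odd and let $q$ be a primitive $N$-th root of unity. Let $\sigma_{ij}=a_{ij}-a_{ji}$, where $a_{ij}$ is the number of angular sectors of the faces delimited by $\lambda_i$ and $\lambda_j$ with $\lambda_i$ coming first. The Chekhov–Fock algebra $\mathcal T_q(\lambda)$ is the complex algebra generated by $X_1^{\pm1},\dots,X_n^{\pm1}$ with the relations $X_iX_j=q^{2\sigma_{ij}}X_jX_i$. For $\mathbf k\in\mathbb Z^n$ put $X_{\mathbf k}=q^{-\sum_{i<j}\sigma_{ij}k_ik_j}X_1^{k_1}\cdots X_n^{k_n}$. Let $H=X_{(1,\dots,1)}$ and, for each puncture $v_j$, let $P_j=X_{\mathbf k_j}$ with $\mathbf k_j=(k_{j1},\dots,k_{jn})$, where $k_{ji}$ is the number of times a small simple loop around $v_j$ meets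 $\lambda_i$. The triangle algebra of a face $T_t$ is $\mathcal T_t=\mathbb C[X_1^{\pm1},X_2^{\pm1},X_3^{\pm1}]$ with $X_iX_{i+1}=q^2X_{i+1}X_i$ (indices mod 3), one generator for each side. Let $\mathfrak i:\mathcal T_q(\lambda)\to\mathcal T_1\otimes\dots\otimes\mathcal T_m$ be the canonical homomorphism that sends $X_e$ to the tensor product of the two generators associated to the two sides of faces lying on $\lambda_e$ if these belong to distinct faces, and to their quantum-ordered product if they belong to the same face. A local representation of $\mathcal T_q(\lambda)$ is a representation isomorphic to $(\rho_1\otimes\dots\otimes\rho_m)\circ\mathfrak i$ with each $\rho_t$ a finite-dimensional irreducible representation of $\mathcal T_t$. Let $\rho:\mathcal T_q(\lambda)\to\mathrm{End}(V)$ be a local representation with edge weights $x_1,\dots,x_n\in\mathbb C^*$ and central charge $c$, i.e. $\rho(X_i^N)=x_i\,\mathrm{Id}$ and $\rho(H)=c\,\mathrm{Id}$, where $c^N=x_1\cdots x_n$. Then there is a finite decomposition $$V=\bigoplus_{i\in\mathcal I}V^{(i)}$$ into invariant subspaces such that the representation $\rho^{(i)}$ on each $V^{(i)}$ is irreducible,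 has the same edge weights $x_1,\dots,x_n$ and the same central charge $c$ (that is, $\rho^{(i)}(X_j^N)=x_j\,\mathrm{Id}$ and $\rho^{(i)}(H)=c\,\mathrm{Id}$), and satisfies $\rho^{(i)}(P_j)=p_j^{(i)}\,\mathrm{Id}$ for every puncture $v_j$, where $$\bigl(p_j^{(i)}\bigr)^N=x_1^{k_{j1}}\cdots x_n^{k_{jn}}\quad(1\le j\le s),\qquad p_1^{(i)}\cdots p_s^{(i)}=c^2 .$$ Components $\rho^{(i)}$ and $\rho^{(i')}$ with $p^{(i)}=p^{(i')}$ are isomorphic. Moreover, for every $(p_1,\dots,p_s)\in\mathbb C^s$ with $p_j^N=x_1^{k_{j1}}\cdots x_n^{k_{jn}}$ for all $j$ and $p_1\cdots p_s=c^2$, there are exactly $N^g$ elements $i\in\mathcal I$ with $p^{(i)}_j=p_j$ for all $j$. -/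

import Mathlib

open scoped TensorProduct

universe u w

noncomputable section

/-! ## Quantum tori: Laurent polynomials in q-commuting variables -/

namespace QuantumTorus

/-- The defining relations: the generator `Sum.inl i` is `X_i`, the generator `Sum.inr i` is its
inverse, and `X_i X_j = q ^ (2 σ_ij) X_j X_i`. -/
inductive Rel {n : ℕ} (σ : Fin n → Fin n → ℤ) (q : ℂˣ) :
    FreeAlgebra ℂ (Fin n ⊕ Fin n) → FreeAlgebra ℂ (Fin n ⊕ Fin n) → Prop
  | mul_inv (i : Fin n) :
      Rel σ q (FreeAlgebra.ι ℂ (Sum.inl i) * FreeAlgebra.ι ℂ (Sum.inr i)) 1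
  | inv_mul (i : Fin n) :
      Rel σ q (FreeAlgebra.ι ℂ (Sum.inr i) * FreeAlgebra.ι ℂ (Sum.inl i)) 1
  | comm (i j : Fin n) :
      Rel σ q (FreeAlgebra.ι ℂ (Sum.inl i) * FreeAlgebra.ι ℂ (Sum.inl j))
        (((q ^ (2 * σ i j) : ℂˣ) : ℂ) •
          (FreeAlgebra.ι ℂ (Sum.inl j) * FreeAlgebra.ι ℂ (Sum.inl i)))

end QuantumTorus

/-- The complex algebra `ℂ[X_1^{±1}, …, X_n^{±1}]_q` generated by `X_1^{±1}, …, X_n^{±1}` subject to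
the relations `X_i X_j = q ^ (2 σ_ij) X_j X_i`. -/
abbrev QuantumTorus {n : ℕ} (σ : Fin n → Fin n → ℤ) (q : ℂˣ) : Type :=
  RingQuot (QuantumTorus.Rel σ q)

namespace QuantumTorus

variable {n : ℕ} (σ : Fin n → Fin n → ℤ) (q : ℂˣ)

/-- The generator `X_i`, as an invertible element. -/
def X (i : Fin n) : (QuantumTorus σ q)ˣ where
  val := RingQuot.mkAlgHom ℂ (Rel σ q) (FreeAlgebra.ι ℂ (Sum.inl i))
  inv := RingQuot.mkAlgHom ℂ (Rel σ q) (FreeAlgebra.ι ℂ (Sum.inr i))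
  val_inv := by
    rw [← map_mul, RingQuot.mkAlgHom_rel ℂ (Rel.mul_inv i), map_one]
  inv_val := by
    rw [← map_mul, RingQuot.mkAlgHom_rel ℂ (Rel.inv_mul i), map_one]

/-- Scalars `q ^ z` as units of an algebra. -/
def qpow (q : ℂˣ) (A : Type*) [Semiring A] [Algebra ℂ A] (z : ℤ) : Aˣ :=
  Units.map (algebraMap ℂ A).toMonoidHom (q ^ z)

theorem qpow_val (q : ℂˣ) (A : Type*) [Semiring A] [Algebra ℂ A] (z : ℤ) :
    ((qpow q A z : Aˣ) : A) = algebraMap ℂ A ((q ^ z : ℂˣ) : ℂ) := rfl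

/-- The quantum-ordered (Weyl-ordered) monomial
`X_k = q ^ (- ∑_{i < j} σ_ij k_i k_j) X_1 ^ k_1 ⋯ X_n ^ k_n` of a multi-index `k ∈ ℤ^n`. -/
def monomial (k : Fin n → ℤ) : (QuantumTorus σ q)ˣ :=
  qpow q (QuantumTorus σ q) (-∑ i, ∑ j, if i < j then σ i j * k i * k j else 0) *
    (List.ofFn fun i => X σ q i ^ k i).prod

variable {σ q}

/-- The universal property: `n` invertible elements that satisfy the relations define an algebra
homomorphism. -/
def lift {A : Type*} [Semiring A] [Algebra ℂ A] (u : Fin n → Aˣ)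
    (hu : ∀ i j, u i * u j = qpow q A (2 * σ i j) * (u j * u i)) : QuantumTorus σ q →ₐ[ℂ] A :=
  RingQuot.liftAlgHom ℂ ⟨FreeAlgebra.lift ℂ
    (Sum.elim (fun i => (u i : A)) (fun i => ((u i)⁻¹ : Aˣ))), by
      intro a b h
      induction h with
      | mul_inv i => simp
      | inv_mul i => simp
      | comm i j =>
        have := congrArg Units.val (hu i j)
        simpa [qpow_val, Algebra.smul_def] using this⟩

theorem lift_X {A : Type*} [Semiring A] [Algebra ℂ A] (u : Fin n → Aˣ)
    (hu : ∀ i j, u i * u j = qpow q A (2 * σ i j) * (u j * u i)) (i : Fin n) :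
    lift u hu (X σ q i : QuantumTorus σ q) = u i := by
  simp [lift, X]

theorem X_mul_X (i j : Fin n) :
    X σ q i * X σ q j = qpow q (QuantumTorus σ q) (2 * σ i j) * (X σ q j * X σ q i) := by
  ext
  have := RingQuot.mkAlgHom_rel ℂ (Rel.comm (σ := σ) (q := q) i j)
  simpa [X, qpow_val, Algebra.smul_def] using this

section Commutation

variable {A : Type*} [Semiring A] [Algebra ℂ A]

theorem qpow_add (a b : ℤ) : qpow q A (a + b) = qpow q A a * qpow q A b := by
  simp [qpow, zpow_add]

theorem qpow_zero : qpow q A 0 = 1 := by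
  simp [qpow]

theorem qpow_comm (a : ℤ) (u : Aˣ) : qpow q A a * u = u * qpow q A a := by
  ext
  simpa [qpow_val] using Algebra.commutes (((q ^ a : ℂˣ) : ℂ)) (u : A)

/-- `u v = q ^ z v u`. -/
def QComm (q : ℂˣ) (u v : Aˣ) (z : ℤ) : Prop := u * v = qpow q A z * (v * u)

theorem QComm.symm {u v : Aˣ} {z : ℤ} (h : QComm q u v z) : QComm q v u (-z) := by
  unfold QComm at *
  rw [h, ← mul_assoc, ← qpow_add, neg_add_cancel, qpow_zero, one_mul]

theorem QComm.qpow_right (u : Aˣ) (a : ℤ) : QComm q u (qpow q A a) 0 := by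
  unfold QComm
  rw [qpow_zero, one_mul, qpow_comm]

theorem QComm.mul_right {u v w : Aˣ} {y z : ℤ} (h : QComm q u v y) (h' : QComm q u w z) :
    QComm q u (v * w) (y + z) := by
  unfold QComm at *
  rw [← mul_assoc, h, mul_assoc, mul_assoc, h', qpow_add, ← mul_assoc v, ← qpow_comm z v]
  simp only [mul_assoc]

theorem QComm.one_right (u : Aˣ) : QComm q u 1 0 := by
  simp [QComm, qpow_zero]

theorem QComm.inv_right {u v : Aˣ} {z : ℤ} (h : QComm q u v z) : QComm q u v⁻¹ (-z) := by
  have h' := h.symm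
  unfold QComm at *
  have : v⁻¹ * (v * u) * v⁻¹ = v⁻¹ * (qpow q A (-z) * (u * v)) * v⁻¹ := by rw [h']
  rw [← mul_assoc (v⁻¹) (qpow q A (-z)), ← qpow_comm] at this
  simpa [mul_assoc] using this

theorem QComm.zpow_right {u v : Aˣ} {z : ℤ} (h : QComm q u v z) (k : ℤ) :
    QComm q u (v ^ k) (k * z) := by
  induction k with
  | zero => simpa using QComm.one_right u
  | succ k ih =>
    rw [zpow_add_one, add_mul, one_mul]
    exact ih.mul_right h
  | pred k ih =>
    rw [zpow_sub_one, sub_mul, one_mul, sub_eq_add_neg]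
    exact ih.mul_right h.inv_right

theorem QComm.ofFn_right {u : Aˣ} {n : ℕ} {v : Fin n → Aˣ} {z : Fin n → ℤ}
    (h : ∀ i, QComm q u (v i) (z i)) : QComm q u (List.ofFn v).prod (∑ i, z i) := by
  induction n with
  | zero => simpa using QComm.one_right u
  | succ n ih =>
    rw [List.ofFn_succ, List.prod_cons, Fin.sum_univ_succ]
    exact (h 0).mul_right (ih fun i => h i.succ)

theorem QComm.monomial_right {u : (QuantumTorus σ q)ˣ} {z : Fin n → ℤ}
    (h : ∀ i, QComm q u (X σ q i) (z i)) (k : Fin n → ℤ) :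
    QComm q u (monomial σ q k) (∑ i, k i * z i) := by
  have := (QComm.qpow_right u (-∑ i, ∑ j, if i < j then σ i j * k i * k j else 0)).mul_right
    (QComm.ofFn_right fun i => (h i).zpow_right (k i))
  rwa [zero_add] at this

/-- Two monomials commute up to an explicit power of `q`. -/
theorem monomial_comm (k l : Fin n → ℤ) :
    QComm q (monomial σ q k) (monomial σ q l) (∑ j, l j * ∑ i, k i * (2 * σ i j)) := by
  refine QComm.monomial_right (fun j => ?_) l
  have h1 : ∀ i, QComm q (X σ q j) (X σ q i) (-(2 * σ i j)) := fun i =>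
    QComm.symm (X_mul_X i j)
  have h2 := (QComm.monomial_right h1 k).symm
  simpa using h2

end Commutation

end QuantumTorus

/-! ## Representations of complex algebras -/

section Rep

variable {A : Type*} [Semiring A] [Algebra ℂ A]

/-- A representation `ρ : A → End(V)` is irreducible if `V ≠ 0` and the only invariant subspaces
are `0` and `V`. -/
def IsIrreducibleRep {V : Type*} [AddCommGroup V] [Module ℂ V]
    (ρ : A →ₐ[ℂ] Module.End ℂ V) : Prop :=
  Nontrivial V ∧
    ∀ U : Submodule ℂ V, (∀ a : A, ∀ u ∈ U, ρ a u ∈ U) → U = ⊥ ∨ U = ⊤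

/-- Two representations are isomorphic if a linear isomorphism intertwines them. -/
def RepIso {V W : Type*} [AddCommGroup V] [Module ℂ V] [AddCommGroup W] [Module ℂ W]
    (ρ : A →ₐ[ℂ] Module.End ℂ V) (τ : A →ₐ[ℂ] Module.End ℂ W) : Prop :=
  ∃ L : V ≃ₗ[ℂ] W, ∀ (a : A) (v : V), L (ρ a v) = τ a (L v)

/-- The representation on an invariant subspace. -/
def subRep {V : Type*} [AddCommGroup V] [Module ℂ V] (ρ : A →ₐ[ℂ] Module.End ℂ V)
    (U : Submodule ℂ V) (hU : ∀ a : A, ∀ u ∈ U, ρ a u ∈ U) : A →ₐ[ℂ] Module.End ℂ U where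
  toFun a := (ρ a).restrict (hU a)
  map_one' := by ext; simp
  map_mul' a b := by ext; simp
  map_zero' := by ext; simp
  map_add' a b := by ext; simp
  commutes' r := by ext; simp [Algebra.algebraMap_eq_smul_one]

/-- The tensor product `ρ_1 ⊗ ⋯ ⊗ ρ_m : A_1 ⊗ ⋯ ⊗ A_m → End(V_1 ⊗ ⋯ ⊗ V_m)` of representations
`ρ_t : A_t → End(V_t)`. -/
def tensorRep {m : ℕ} {B : Fin m → Type*} [∀ t, Semiring (B t)] [∀ t, Algebra ℂ (B t)]
    {V : Fin m → Type*} [∀ t, AddCommGroup (V t)] [∀ t, Module ℂ (V t)]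
    (ρ : ∀ t, B t →ₐ[ℂ] Module.End ℂ (V t)) :
    (⨂[ℂ] t, B t) →ₐ[ℂ] Module.End ℂ (⨂[ℂ] t, V t) :=
  PiTensorProduct.liftAlgHom
    ((PiTensorProduct.mapMultilinear ℂ V V).compLinearMap fun t => (ρ t).toLinearMap)
    (by
      simp only [MultilinearMap.compLinearMap_apply, PiTensorProduct.mapMultilinear_apply]
      simp)
    (by
      intro x y
      simp only [MultilinearMap.compLinearMap_apply, PiTensorProduct.mapMultilinear_apply]
      simp [← PiTensorProduct.map_mul])

end Rep

/-! ## Ideal triangulations -/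

/-- The side that follows a given side of a triangle in the cyclic order. -/
def nextSide {m : ℕ} (d : Fin m × Fin 3) : Fin m × Fin 3 := (d.1, d.2 + 1)

/-- An ideal triangulation of a connected oriented punctured surface, with faces `T_1, …, T_m`,
edges `λ_1, …, λ_n` and punctures `v_1, …, v_s`, as a gluing of `m` oriented triangles along
their sides (two sides of the same triangle may be glued).

The pair `(t, i)` is the `i`-th side of the face `t`; the sides of a face are numbered cyclically,
in the order for which in the angular sector between the sides `i` and `i + 1` the side `i` comes
first. All triangles carry the orientation of the surface, and gluings reverse the induced
orientation of the sides. Each side `d` determines the corner of its face between `d` and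
`nextSide d`. -/
structure IdealTriangulation (m n s : ℕ) where
  /-- the side to which a side is glued -/
  opp : Fin m × Fin 3 → Fin m × Fin 3
  opp_opp : ∀ d, opp (opp d) = d
  opp_ne : ∀ d, opp d ≠ d
  /-- the surface is nonempty … -/
  faces_pos : 0 < m
  /-- … and connected -/
  connected : ∀ t t' : Fin m,
    Relation.ReflTransGen (fun a b : Fin m => ∃ i j : Fin 3, opp (a, i) = (b, j)) t t'
  /-- the edge that a side becomes in the surface -/
  edge : Fin m × Fin 3 → Fin n
  edge_surjective : Function.Surjective edge
  edge_eq_iff : ∀ d d', edge d = edge d' ↔ d' = d ∨ d' = opp d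
  /-- the puncture at the corner between `d` and `nextSide d`; turning around it, one passes from
  this corner through the side `nextSide d` to the corner after `opp (nextSide d)` -/
  puncture : Fin m × Fin 3 → Fin s
  puncture_surjective : Function.Surjective puncture
  puncture_eq_iff : ∀ d d', puncture d = puncture d' ↔
    Relation.EqvGen (fun a b => b = opp (nextSide a)) d d'

/-- `σ` for a single triangle: `X_i X_{i+1} = q² X_{i+1} X_i`. -/
def triangleForm (i j : Fin 3) : ℤ := if j = i + 1 then 1 else if i = j + 1 then -1 else 0

/-- The triangle algebra `ℂ[X_1^{±1}, X_2^{±1}, X_3^{±1}]_q`, `X_i X_{i+1} = q² X_{i+1} X_i`. -/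
abbrev TriangleAlgebra (q : ℂˣ) : Type := QuantumTorus triangleForm q

namespace IdealTriangulation

variable {m n s : ℕ} (T : IdealTriangulation m n s)

/-- The surface has genus `g`: the Euler characteristic of the closed surface obtained by filling in
the punctures is `2 - 2 g`. -/
def HasGenus (_T : IdealTriangulation m n s) (g : ℕ) : Prop :=
  (s : ℤ) - n + m = 2 - 2 * g

/-- `a_ij`: the number of angular sectors of the faces delimited by `λ_i` and `λ_j` with `λ_i`
coming first. -/
def sectors (i j : Fin n) : ℕ :=
  (Finset.univ.filter fun d : Fin m × Fin 3 => T.edge d = i ∧ T.edge (nextSide d) = j).card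

/-- `σ_ij = a_ij - a_ji`. -/
def form (i j : Fin n) : ℤ := (T.sectors i j : ℤ) - T.sectors j i

/-- The Chekhov-Fock algebra of the triangulation. -/
abbrev ChekhovFock (q : ℂˣ) : Type := QuantumTorus T.form q

/-- `k_ji`: the number of times a small simple loop around the puncture `v_j` crosses the edge
`λ_i`. The loop goes through all the corners at `v_j` and leaves the corner between `d` and
`nextSide d` through the side `nextSide d`. -/
def crossings (j : Fin s) (i : Fin n) : ℕ :=
  (Finset.univ.filter fun d : Fin m × Fin 3 => T.puncture d = j ∧ T.edge (nextSide d) = i).card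

/-- The puncture invariant `P_j`, the monomial of the multi-index `(k_j1, …, k_jn)`. -/
def punctureInvariant (q : ℂˣ) (j : Fin s) : T.ChekhovFock q :=
  QuantumTorus.monomial T.form q fun i => (T.crossings j i : ℤ)

/-- The element `H`, the monomial of the multi-index `(1, …, 1)`. -/
def H (q : ℂˣ) : T.ChekhovFock q := QuantumTorus.monomial T.form q fun _ => 1

/-- The image of `X_e` in the product of the triangle algebras has, at the face `t`, the monomial of
the multi-index that is `1` at the sides of `t` lying on `λ_e` and `0` at the other sides. It is the
generator of the side if just one side of `t` lies on `λ_e`, the quantum-ordered product of two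
generators if two sides do, and `1` if none does. -/
def sideIndex (e : Fin n) (t : Fin m) (i : Fin 3) : ℤ := if T.edge (t, i) = e then 1 else 0

theorem form_eq (e f : Fin n) : T.form e f =
    ∑ t, ∑ j, T.sideIndex f t j * ∑ i, T.sideIndex e t i * triangleForm i j := by
  unfold form sectors
  rw [Finset.card_filter, Finset.card_filter, Fintype.sum_prod_type, Fintype.sum_prod_type]
  push_cast
  rw [← Finset.sum_sub_distrib]
  refine Finset.sum_congr rfl fun t _ => ?_
  have hand : ∀ (P Q : Prop) [Decidable P] [Decidable Q],
      (if P ∧ Q then (1 : ℤ) else 0) = (if P then 1 else 0) * (if Q then 1 else 0) := by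
    intro P Q _ _
    by_cases P <;> by_cases Q <;> simp [*]
  have h12 : (1 : Fin 3) + 1 = 2 := rfl
  have h20 : (2 : Fin 3) + 1 = 0 := rfl
  have f00 : triangleForm 0 0 = 0 := rfl
  have f01 : triangleForm 0 1 = 1 := rfl
  have f02 : triangleForm 0 2 = -1 := rfl
  have f10 : triangleForm 1 0 = -1 := rfl
  have f11 : triangleForm 1 1 = 0 := rfl
  have f12 : triangleForm 1 2 = 1 := rfl
  have f20 : triangleForm 2 0 = 1 := rfl
  have f21 : triangleForm 2 1 = -1 := rfl
  have f22 : triangleForm 2 2 = 0 := rfl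
  simp only [Fin.sum_univ_three, nextSide, sideIndex, hand, zero_add, h12, h20, f00, f01, f02,
    f10, f11, f12, f20, f21, f22]
  ring

/-- The element of `𝒯_1 ⊗ ⋯ ⊗ 𝒯_m` associated to the edge `λ_e`, as an invertible element. -/
def tensorGen (q : ℂˣ) (e : Fin n) : (⨂[ℂ] _t : Fin m, TriangleAlgebra q)ˣ :=
  Units.map (PiTensorProduct.tprodMonoidHom ℂ)
    (MulEquiv.piUnits.symm fun t => QuantumTorus.monomial triangleForm q (T.sideIndex e t))

theorem tensorGen_comm (q : ℂˣ) (e f : Fin n) :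
    T.tensorGen q e * T.tensorGen q f =
      QuantumTorus.qpow q (⨂[ℂ] _t : Fin m, TriangleAlgebra q) (2 * T.form e f) * (T.tensorGen q f * T.tensorGen q e) := by
  let M : Fin n → Fin m → TriangleAlgebra q := fun e t =>
    (QuantumTorus.monomial triangleForm q (T.sideIndex e t) : TriangleAlgebra q)
  let z : Fin m → ℤ := fun t =>
    ∑ j, T.sideIndex f t j * ∑ i, T.sideIndex e t i * (2 * triangleForm i j)
  have hz : ∑ t, z t = 2 * T.form e f := by
    rw [form_eq]
    simp only [z, Finset.mul_sum]
    refine Finset.sum_congr rfl fun t _ => Finset.sum_congr rfl fun j _ =>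
      Finset.sum_congr rfl fun i _ => ?_
    ring
  have hM : M e * M f = fun t => ((q ^ z t : ℂˣ) : ℂ) • (M f * M e) t := by
    funext t
    have := congrArg Units.val (QuantumTorus.monomial_comm (σ := triangleForm) (q := q)
      (T.sideIndex e t) (T.sideIndex f t))
    simpa [QuantumTorus.qpow_val, Algebra.smul_def, M, z] using this
  have hq : ∏ t, ((q ^ z t : ℂˣ) : ℂ) = ((q ^ (2 * T.form e f) : ℂˣ) : ℂ) := by
    rw [← hz, ← Units.coe_prod]
    congr 1
    generalize (Finset.univ : Finset (Fin m)) = S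
    induction S using Finset.cons_induction with
    | empty => simp
    | cons a S ha ih => rw [Finset.prod_cons, Finset.sum_cons, zpow_add, ih]
  ext
  change PiTensorProduct.tprod ℂ (M e) * PiTensorProduct.tprod ℂ (M f) =
    algebraMap ℂ _ ((q ^ (2 * T.form e f) : ℂˣ) : ℂ) *
      (PiTensorProduct.tprod ℂ (M f) * PiTensorProduct.tprod ℂ (M e))
  rw [PiTensorProduct.tprod_mul_tprod, PiTensorProduct.tprod_mul_tprod, hM,
    MultilinearMap.map_smul_univ, hq]
  exact Algebra.smul_def (A := ⨂[ℂ] _t : Fin m, TriangleAlgebra q) _ _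

/-- The canonical homomorphism `𝒯_q(λ) → 𝒯_1 ⊗ ⋯ ⊗ 𝒯_m`. -/
def embed (q : ℂˣ) : T.ChekhovFock q →ₐ[ℂ] ⨂[ℂ] _t : Fin m, TriangleAlgebra q :=
  QuantumTorus.lift (T.tensorGen q) (T.tensorGen_comm q)

theorem embed_X (q : ℂˣ) (e : Fin n) :
    T.embed q (QuantumTorus.X T.form q e : T.ChekhovFock q) =
      PiTensorProduct.tprod ℂ fun t =>
        (QuantumTorus.monomial triangleForm q (T.sideIndex e t) : TriangleAlgebra q) :=
  QuantumTorus.lift_X _ _ e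

/-- A local representation: up to isomorphism it is `(ρ_1 ⊗ ⋯ ⊗ ρ_m) ∘ 𝔦`, where each `ρ_t` is an
irreducible finite-dimensional representation of the triangle algebra of the face `t` and `𝔦` is the
canonical homomorphism into the tensor product of the triangle algebras. -/
def IsLocalRep (q : ℂˣ) {V : Type u} [AddCommGroup V] [Module ℂ V]
    (ρ : T.ChekhovFock q →ₐ[ℂ] Module.End ℂ V) : Prop :=
  ∃ (W : Fin m → Type w) (_ : ∀ t, AddCommGroup (W t)) (_ : ∀ t, Module ℂ (W t))
    (τ : ∀ t, TriangleAlgebra q →ₐ[ℂ] Module.End ℂ (W t)),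
    (∀ t, FiniteDimensional ℂ (W t) ∧ IsIrreducibleRep (τ t)) ∧
      RepIso ρ ((tensorRep τ).comp (T.embed q))

/-- `ρ` has edge weights `x_i` and central charge `c`: `ρ(X_i ^ N) = x_i Id` and `ρ(H) = c Id`,
where `x_i ≠ 0` and `c` is an `N`-th root of `x_1 ⋯ x_n`. -/
structure HasWeights (q : ℂˣ) (N : ℕ) {V : Type*} [AddCommGroup V] [Module ℂ V]
    (ρ : T.ChekhovFock q →ₐ[ℂ] Module.End ℂ V) (x : Fin n → ℂ) (c : ℂ) : Prop where
  weight_ne_zero : ∀ i, x i ≠ 0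
  charge_pow : c ^ N = ∏ i, x i
  edge_eq : ∀ i, ρ ((QuantumTorus.X T.form q i : T.ChekhovFock q) ^ N) = x i • 1
  charge_eq : ρ (T.H q) = c • 1

/-- An admissible choice of puncture weights: each `p_j` is an `N`-th root of
`x_1 ^ k_j1 ⋯ x_n ^ k_jn`, and `c` is a square root of the product of all `p_j`. -/
def AdmissiblePunctureWeights (N : ℕ) (x : Fin n → ℂ) (c : ℂ) (p : Fin s → ℂ) : Prop :=
  (∀ j, p j ^ N = ∏ i, x i ^ T.crossings j i) ∧ c ^ 2 = ∏ j, p j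

/-- `ρ` is an irreducible representation classified by the edge weights `x`, the puncture weights
`p` and the central charge `c`. -/
structure IsIrreducibleWithWeights (q : ℂˣ) (N : ℕ) {V : Type*} [AddCommGroup V] [Module ℂ V]
    (ρ : T.ChekhovFock q →ₐ[ℂ] Module.End ℂ V) (x : Fin n → ℂ) (c : ℂ) (p : Fin s → ℂ) :
    Prop where
  irreducible : IsIrreducibleRep ρ
  hasWeights : T.HasWeights q N ρ x c
  admissible : T.AdmissiblePunctureWeights N x c p
  puncture_eq : ∀ j, ρ (T.punctureInvariant q j) = p j • 1

end IdealTriangulation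

end

/-! Since `q ^ N = 1`, in a representation with edge weights `x` a monomial depends, up to a scalar
fixed by `x`, only on its multi-index mod `N`. Such a representation is therefore a projective
representation of the finite group `(ℤ/N)^n`, with a multiplier determined by `q`, `σ` and `x`.
Maschke's theorem gives complete reducibility, and Schur orthogonality gives two facts about
irreducibles: `dim² · |radical| = N ^ n` (`IsProjectiveRep.finrank_sq_mul_card_radical`), and two of
them with the same scalars on the radical are isomorphic (`IsProjectiveRep.exists_linearEquiv`).

As `N` is odd, the radical is the kernel of `σ` mod `N`. A kernel vector assigns a well-defined
value to each puncture, so the kernel is freely spanned by the `s` puncture multi-indices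
(`crossingSum_injective`, `exists_crossingSum_eq`). Hence the `p_j`, with the edge weights,
determine an irreducible component, whose dimension is `N ^ ((n - s) / 2) = N ^ (s + 3 g - 3)`.

Multiplicities come from Fourier inversion on the traces of `∏ P_v ^ a_v`, `0 ≤ a_v < N`. In a local
representation such a trace vanishes unless the exponents agree mod `N` on the sides of every face
(`IsLocalRep.exponent_nextSide`). By connectedness this leaves only constant `a = b`, where the
operator is `H ^ (2 b)` with trace `c ^ (2 b) N ^ m`. Summing against the character of an admissible
`p₀` gives `N · N ^ m` (`IsLocalRep.sum_trace`); computed on the components, the same sum is `N ^ (s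
+ 3 g - 3) · N ^ s` times the multiplicity. The Euler characteristic turns the quotient into `N ^
g`. -/

noncomputable section

/-! ## Families of operators and Schur's lemma -/

section OperatorFamily

variable {ι : Type*} {V V' : Type*} [AddCommGroup V] [Module ℂ V] [AddCommGroup V'] [Module ℂ V']

/-- A family of operators acts irreducibly. -/
def IsIrreducibleFamily (D : ι → Module.End ℂ V) : Prop :=
  Nontrivial V ∧ ∀ U : Submodule ℂ V, (∀ i, ∀ u ∈ U, D i u ∈ U) → U = ⊥ ∨ U = ⊤

/-- Any eigenspace of `f` is invariant. Stating this for families of operators covers both the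
action of all monomials and that of residue classes. -/
theorem IsIrreducibleFamily.exists_eq_smul_one [FiniteDimensional ℂ V] {D : ι → Module.End ℂ V}
    (hD : IsIrreducibleFamily D) (f : Module.End ℂ V) (hf : ∀ i, D i * f = f * D i) :
    ∃ z : ℂ, f = z • 1 := by
  have := hD.1
  obtain ⟨z, hz⟩ := Module.End.exists_eigenvalue f
  refine ⟨z, ?_⟩
  have hinv : ∀ i, ∀ u ∈ f.eigenspace z, D i u ∈ f.eigenspace z := by
    intro i u hu
    rw [Module.End.mem_eigenspace_iff] at hu ⊢
    rw [← Module.End.mul_apply, ← hf i, Module.End.mul_apply, hu, map_smul]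
  rcases hD.2 _ hinv with h | h
  · exact absurd h hz
  · ext u
    have hu : u ∈ f.eigenspace z := h ▸ Submodule.mem_top
    simpa using Module.End.mem_eigenspace_iff.1 hu

theorem IsIrreducibleFamily.eq_zero_or_bijective {D : ι → Module.End ℂ V}
    {D' : ι → Module.End ℂ V'} (hD : IsIrreducibleFamily D) (hD' : IsIrreducibleFamily D')
    (f : V →ₗ[ℂ] V') (hf : ∀ i v, D' i (f v) = f (D i v)) : f = 0 ∨ Function.Bijective f := by
  have hker : ∀ i, ∀ u ∈ LinearMap.ker f, D i u ∈ LinearMap.ker f := by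
    intro i u hu
    rw [LinearMap.mem_ker] at hu ⊢
    rw [← hf, hu, map_zero]
  have hran : ∀ i, ∀ u ∈ LinearMap.range f, D' i u ∈ LinearMap.range f := by
    rintro i _ ⟨u, rfl⟩
    exact ⟨D i u, (hf i u).symm⟩
  rcases hD.2 _ hker with h | h
  · rcases hD'.2 _ hran with h' | h'
    · exact Or.inl (LinearMap.range_eq_bot.1 h')
    · exact Or.inr ⟨LinearMap.ker_eq_bot.1 h, LinearMap.range_eq_top.1 h'⟩
  · exact Or.inl (LinearMap.ker_eq_top.1 h)

/-- An operator that commutes with an invertible operator up to a factor different from `1` has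
trace zero. -/
theorem trace_eq_zero_of_mul_eq_smul_mul (Y : (Module.End ℂ V)ˣ) (Z : Module.End ℂ V) (z : ℂ)
    (hz : z ≠ 1) (h : (Y : Module.End ℂ V) * Z = z • (Z * Y)) : LinearMap.trace ℂ V Z = 0 := by
  have h1 : LinearMap.trace ℂ V (Y * Z * (Y⁻¹ : (Module.End ℂ V)ˣ)) = LinearMap.trace ℂ V Z :=
    LinearMap.trace_conj ℂ Z Y
  rw [h, smul_mul_assoc, mul_assoc, Units.mul_inv, mul_one, map_smul, smul_eq_mul] at h1
  have h2 : (z - 1) * LinearMap.trace ℂ V Z = 0 := by linear_combination h1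
  exact (mul_eq_zero.1 h2).resolve_left (sub_ne_zero.2 hz)

end OperatorFamily

/-! ## Projective representations of finite abelian groups -/

/-- A projective representation with multiplier `μ`. -/
structure IsProjectiveRep {G : Type*} [AddCommGroup G] {V : Type*} [AddCommGroup V] [Module ℂ V]
    (μ : G → G → ℂ) (D : G → (Module.End ℂ V)ˣ) : Prop where
  mul : ∀ g h, (D g : Module.End ℂ V) * D h = μ g h • (D (g + h) : Module.End ℂ V)
  ne_zero : ∀ g h, μ g h ≠ 0

/-- The radical of the commutator pairing of the multiplier. -/
def IsProjectiveRep.radical {G : Type*} [Fintype G] (μ : G → G → ℂ) : Finset G :=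
  open Classical in Finset.univ.filter fun g => ∀ h, μ g h = μ h g

theorem IsProjectiveRep.mem_radical {G : Type*} [Fintype G] {μ : G → G → ℂ} {g : G} :
    g ∈ radical μ ↔ ∀ h, μ g h = μ h g := by
  classical
  simp [radical]

/-- The sum of the conjugates of a linear map. -/
def IsProjectiveRep.conjSum {G : Type*} [Fintype G] {V V' : Type*} [AddCommGroup V] [Module ℂ V]
    [AddCommGroup V'] [Module ℂ V'] (D : G → (Module.End ℂ V)ˣ) (D' : G → (Module.End ℂ V')ˣ)
    (f : V →ₗ[ℂ] V') : V →ₗ[ℂ] V' :=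
  ∑ g, (D' g : Module.End ℂ V') ∘ₗ f ∘ₗ (((D g)⁻¹ : (Module.End ℂ V)ˣ) : Module.End ℂ V)

theorem IsProjectiveRep.conjSum_apply {G : Type*} [Fintype G] {V V' : Type*} [AddCommGroup V]
    [Module ℂ V] [AddCommGroup V'] [Module ℂ V'] (D : G → (Module.End ℂ V)ˣ)
    (D' : G → (Module.End ℂ V')ˣ) (f : V →ₗ[ℂ] V') (v : V) : conjSum D D' f v =
    ∑ g, (D' g : Module.End ℂ V')
      (f ((((D g)⁻¹ : (Module.End ℂ V)ˣ) : Module.End ℂ V) v)) := by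
  simp [conjSum]

/-- Schur orthogonality before averaging is evaluated: the product of two characters is a sum of
matrix coefficients of conjugated elementary maps `b i ↦ b' j`. -/
theorem IsProjectiveRep.sum_trace_mul_trace {G : Type*} [Fintype G] {V V' : Type*}
    [AddCommGroup V] [Module ℂ V] [AddCommGroup V'] [Module ℂ V'] (D : G → (Module.End ℂ V)ˣ)
    (D' : G → (Module.End ℂ V')ˣ) {κ κ' : Type*} [Fintype κ] [Fintype κ'] [DecidableEq κ]
    [DecidableEq κ'] (b : Module.Basis κ ℂ V) (b' : Module.Basis κ' ℂ V') :
    ∑ g, LinearMap.trace ℂ V' (D' g : Module.End ℂ V') *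
        LinearMap.trace ℂ V (((D g)⁻¹ : (Module.End ℂ V)ˣ) : Module.End ℂ V) =
      ∑ i, ∑ j, b'.coord j (conjSum D D' ((b.coord i).smulRight (b' j)) (b i)) := by
  have h1 : ∀ g i j, b'.coord j ((D' g : Module.End ℂ V') (((b.coord i).smulRight (b' j))
      ((((D g)⁻¹ : (Module.End ℂ V)ˣ) : Module.End ℂ V) (b i)))) =
      b'.repr ((D' g : Module.End ℂ V') (b' j)) j *
        b.repr ((((D g)⁻¹ : (Module.End ℂ V)ˣ) : Module.End ℂ V) (b i)) i := by
    intro g i j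
    simp only [LinearMap.smulRight_apply, map_smul, smul_eq_mul, Module.Basis.coord_apply]
    ring
  simp only [conjSum_apply, map_sum, h1]
  simp only [LinearMap.trace_eq_matrix_trace ℂ b, LinearMap.trace_eq_matrix_trace ℂ b',
    Matrix.trace, Matrix.diag, LinearMap.toMatrix_apply]
  simp only [Finset.sum_mul_sum]
  rw [Finset.sum_comm, Finset.sum_comm (s := (Finset.univ : Finset κ))]
  exact Finset.sum_congr rfl fun j _ => Finset.sum_comm

namespace IsProjectiveRep

variable {G : Type*} [AddCommGroup G] {V V' : Type*} [AddCommGroup V] [Module ℂ V]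
  [AddCommGroup V'] [Module ℂ V'] {μ : G → G → ℂ} {D : G → (Module.End ℂ V)ˣ}
  {D' : G → (Module.End ℂ V')ˣ}

theorem mul_comm (hD : IsProjectiveRep μ D) (g h : G) :
    (D g : Module.End ℂ V) * D h = (μ g h / μ h g) • ((D h : Module.End ℂ V) * D g) := by
  rw [hD.mul g h, hD.mul h g, smul_smul, div_mul_cancel₀ _ (hD.ne_zero h g), add_comm]

theorem inv_eq (hD : IsProjectiveRep μ D) (h g : G) :
    (((D g)⁻¹ : (Module.End ℂ V)ˣ) : Module.End ℂ V) =
      (μ h g)⁻¹ • ((((D (h + g))⁻¹ : (Module.End ℂ V)ˣ) : Module.End ℂ V) * D h) := by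
  have h1 := congrArg (fun f => (((D (h + g))⁻¹ : (Module.End ℂ V)ˣ) : Module.End ℂ V) * f *
    (((D g)⁻¹ : (Module.End ℂ V)ˣ) : Module.End ℂ V)) (hD.mul h g)
  simp only [mul_assoc, Units.mul_inv, mul_one, mul_smul_comm, smul_mul_assoc] at h1
  rw [h1, ← mul_assoc, Units.inv_mul, one_mul, smul_smul, inv_mul_cancel₀ (hD.ne_zero h g),
    one_smul]

variable [Fintype G]

/-- Translate the summation variable by `h`. The factors `μ h g` and `(μ h g)⁻¹` cancel because both
representations have the same multiplier. -/
theorem conjSum_intertwines (hD : IsProjectiveRep μ D) (hD' : IsProjectiveRep μ D')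
    (f : V →ₗ[ℂ] V') (h : G) (v : V) :
    (D' h : Module.End ℂ V') (conjSum D D' f v) =
      conjSum D D' f ((D h : Module.End ℂ V) v) := by
  rw [conjSum_apply, conjSum_apply, map_sum,
    ← Equiv.sum_comp (Equiv.addLeft h) fun g => (D' g : Module.End ℂ V')
      (f ((((D g)⁻¹ : (Module.End ℂ V)ˣ) : Module.End ℂ V) ((D h : Module.End ℂ V) v)))]
  refine Finset.sum_congr rfl fun g _ => ?_
  rw [hD.inv_eq h g, ← Module.End.mul_apply, hD'.mul h g, Equiv.coe_addLeft]
  simp [smul_smul, hD.ne_zero h g]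

/-- Maschke's theorem. -/
theorem exists_isCompl (hD : IsProjectiveRep μ D) (U : Submodule ℂ V)
    (hU : ∀ g, ∀ u ∈ U, (D g : Module.End ℂ V) u ∈ U)
    (hU' : ∀ g, ∀ u ∈ U, (((D g)⁻¹ : (Module.End ℂ V)ˣ) : Module.End ℂ V) u ∈ U) :
    ∃ U' : Submodule ℂ V, (∀ g, ∀ u ∈ U', (D g : Module.End ℂ V) u ∈ U') ∧ IsCompl U U' := by
  obtain ⟨p, hp⟩ := LinearMap.exists_leftInverse_of_injective U.subtype U.ker_subtype
  have hp1 : ∀ u : V, ∀ hu : u ∈ U, ((p u : U) : V) = u := fun u hu =>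
    congrArg Subtype.val (LinearMap.congr_fun hp ⟨u, hu⟩)
  -- Averaging a projection onto `U` gives an intertwiner that is multiplication by `|G|` on `U`;
  -- its kernel is the complement.
  set P : V →ₗ[ℂ] V := conjSum D D (U.subtype ∘ₗ p) with hP
  have hPU : ∀ u ∈ U, P u = (Fintype.card G : ℂ) • u := by
    intro u hu
    rw [hP, conjSum_apply]
    have : ∀ g ∈ Finset.univ, (D g : Module.End ℂ V) ((U.subtype ∘ₗ p)
        ((((D g)⁻¹ : (Module.End ℂ V)ˣ) : Module.End ℂ V) u)) = u := by
      intro g _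
      have h1 := hp1 _ (hU' g u hu)
      simp only [LinearMap.comp_apply, Submodule.subtype_apply]
      rw [h1, ← Module.End.mul_apply, Units.mul_inv, Module.End.one_apply]
    rw [Finset.sum_congr rfl this, Finset.sum_const, Finset.card_univ, Nat.cast_smul_eq_nsmul]
  have hPm : ∀ v, P v ∈ U := by
    intro v
    rw [hP, conjSum_apply]
    exact Submodule.sum_mem _ fun g _ => hU g _ (p _).2
  have hc : (Fintype.card G : ℂ) ≠ 0 := Nat.cast_ne_zero.2 Fintype.card_ne_zero
  refine ⟨LinearMap.ker P, ?_, ?_⟩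
  · intro g u hu
    rw [LinearMap.mem_ker] at hu ⊢
    rw [hP, ← hD.conjSum_intertwines hD, ← hP, hu, map_zero]
  · constructor
    · rw [Submodule.disjoint_def]
      intro u hu hu'
      rw [LinearMap.mem_ker, hPU u hu] at hu'
      exact (smul_eq_zero.1 hu').resolve_left hc
    · rw [codisjoint_iff, eq_top_iff]
      intro v _
      rw [Submodule.mem_sup]
      refine ⟨(Fintype.card G : ℂ)⁻¹ • P v, U.smul_mem _ (hPm v),
        v - (Fintype.card G : ℂ)⁻¹ • P v, ?_, by abel⟩
      rw [LinearMap.mem_ker, map_sub, map_smul, hPU _ (hPm v), smul_smul, inv_mul_cancel₀ hc,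
        one_smul, sub_self]

/-- Outside the radical, some `D h` commutes with `D g` only up to a factor different from `1`. -/
theorem trace_eq_zero (hD : IsProjectiveRep μ D) {g : G} (hg : g ∉ radical μ) :
    LinearMap.trace ℂ V (D g : Module.End ℂ V) = 0 := by
  rw [mem_radical] at hg
  push Not at hg
  obtain ⟨h, hh⟩ := hg
  refine trace_eq_zero_of_mul_eq_smul_mul (D h) _ (μ h g / μ g h) ?_ (hD.mul_comm h g)
  rw [Ne, div_eq_one_iff_eq (hD.ne_zero g h)]
  exact hh.symm

theorem exists_eq_smul_one [FiniteDimensional ℂ V] (hD : IsProjectiveRep μ D)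
    (hirr : IsIrreducibleFamily fun g => (D g : Module.End ℂ V)) {g : G} (hg : g ∈ radical μ) :
    ∃ z : ℂ, (D g : Module.End ℂ V) = z • 1 := by
  refine hirr.exists_eq_smul_one _ fun h => ?_
  rw [hD.mul, hD.mul, mem_radical.1 hg, add_comm]

/-- Only the radical contributes, and there the scalars `z` and `z⁻¹` cancel, leaving the product of
the dimensions for each element. -/
theorem sum_trace_mul_trace_eq [FiniteDimensional ℂ V] [FiniteDimensional ℂ V'] [Nontrivial V]
    (hD' : IsProjectiveRep μ D')
    (h : ∀ g ∈ radical μ, ∃ z : ℂ, (D g : Module.End ℂ V) = z • 1 ∧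
      (D' g : Module.End ℂ V') = z • 1) :
    ∑ g, LinearMap.trace ℂ V' (D' g : Module.End ℂ V') *
        LinearMap.trace ℂ V (((D g)⁻¹ : (Module.End ℂ V)ˣ) : Module.End ℂ V) =
      (radical μ).card * (Module.finrank ℂ V * Module.finrank ℂ V') := by
  rw [← Finset.sum_subset (Finset.subset_univ (radical μ))
    fun g _ hg => by rw [hD'.trace_eq_zero hg, zero_mul], ← nsmul_eq_mul, ← Finset.sum_const]
  refine Finset.sum_congr rfl fun g hg => ?_
  obtain ⟨z, hz, hz'⟩ := h g hg
  have hz0 : z ≠ 0 := by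
    rintro rfl
    rw [zero_smul] at hz
    exact (D g).ne_zero hz
  have hinv : (((D g)⁻¹ : (Module.End ℂ V)ˣ) : Module.End ℂ V) = z⁻¹ • 1 := by
    rw [← Units.mul_right_inj (D g), Units.mul_inv, hz]
    simp [hz0]
  rw [hz', hinv, map_smul, map_smul, LinearMap.trace_one, LinearMap.trace_one, smul_eq_mul,
    smul_eq_mul]
  field_simp

/-- The square of the dimension of an irreducible projective representation. -/
theorem finrank_sq_mul_card_radical [FiniteDimensional ℂ V] (hD : IsProjectiveRep μ D)
    (hirr : IsIrreducibleFamily fun g => (D g : Module.End ℂ V)) :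
    Module.finrank ℂ V ^ 2 * (radical μ).card = Fintype.card G := by
  have := hirr.1
  have hd : (Module.finrank ℂ V : ℂ) ≠ 0 := Nat.cast_ne_zero.2 Module.finrank_pos.ne'
  have h1 := sum_trace_mul_trace_eq (D := D) hD fun g hg =>
    (hD.exists_eq_smul_one hirr hg).imp fun z hz => ⟨hz, hz⟩
  have b := Module.finBasis ℂ V
  rw [sum_trace_mul_trace D D b b] at h1
  -- The average is a scalar by Schur's lemma, and its trace `|G| · tr f` identifies the scalar.
  have h2 : ∀ f : Module.End ℂ V, conjSum D D f =
      ((Fintype.card G : ℂ) * LinearMap.trace ℂ V f / Module.finrank ℂ V) • 1 := by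
    intro f
    obtain ⟨z, hz⟩ := hirr.exists_eq_smul_one (conjSum D D f) fun h =>
      LinearMap.ext fun v => hD.conjSum_intertwines hD f h v
    have htr : LinearMap.trace ℂ V (conjSum D D f) =
        (Fintype.card G : ℂ) * LinearMap.trace ℂ V f := by
      rw [conjSum, map_sum, Finset.sum_congr rfl fun g _ => ?_, Finset.sum_const,
        Finset.card_univ, nsmul_eq_mul]
      exact LinearMap.trace_conj ℂ f (D g)
    rw [hz, map_smul, LinearMap.trace_one, smul_eq_mul] at htr
    rw [hz, ← htr, mul_div_cancel_right₀ _ hd]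
  have h3 : ∀ i j, b.coord j (conjSum D D ((b.coord i).smulRight (b j)) (b i)) =
      if i = j then (Fintype.card G : ℂ) / Module.finrank ℂ V else 0 := by
    intro i j
    rw [h2]
    by_cases hij : i = j
    · subst hij
      simp [LinearMap.trace_smulRight]
    · simp [hij]
  simp only [h3, Finset.sum_ite_eq, Finset.mem_univ, if_true, Finset.sum_const, Finset.card_univ,
    Fintype.card_fin, nsmul_eq_mul] at h1
  rw [mul_div_cancel₀ _ hd] at h1
  have h4 : ((Module.finrank ℂ V ^ 2 * (radical μ).card : ℕ) : ℂ) = (Fintype.card G : ℕ) := by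
    rw [h1]
    push_cast
    ring
  exact_mod_cast h4

/-- Irreducible projective representations with the same multiplier that agree on the radical are
isomorphic. -/
theorem exists_linearEquiv [FiniteDimensional ℂ V] [FiniteDimensional ℂ V']
    (hD : IsProjectiveRep μ D) (hD' : IsProjectiveRep μ D')
    (hirr : IsIrreducibleFamily fun g => (D g : Module.End ℂ V))
    (hirr' : IsIrreducibleFamily fun g => (D' g : Module.End ℂ V'))
    (h : ∀ g ∈ radical μ, ∃ z : ℂ, (D g : Module.End ℂ V) = z • 1 ∧
      (D' g : Module.End ℂ V') = z • 1) :
    ∃ L : V ≃ₗ[ℂ] V', ∀ g v, L ((D g : Module.End ℂ V) v) = (D' g : Module.End ℂ V') (L v) := by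
  have := hirr.1
  have := hirr'.1
  by_contra hL
  -- Without an isomorphism every averaged map vanishes, so the character sum is zero, although it
  -- equals `|radical| · dim V · dim V'`.
  have h0 : ∀ f : V →ₗ[ℂ] V', conjSum D D' f = 0 := by
    intro f
    refine (hirr.eq_zero_or_bijective hirr' _ fun g v =>
      hD.conjSum_intertwines hD' f g v).resolve_right fun hb => hL ?_
    exact ⟨LinearEquiv.ofBijective _ hb, fun g v => (hD.conjSum_intertwines hD' f g v).symm⟩
  have h1 := sum_trace_mul_trace_eq (D := D) hD' h
  rw [sum_trace_mul_trace D D' (Module.finBasis ℂ V) (Module.finBasis ℂ V')] at h1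
  simp only [h0, LinearMap.zero_apply, map_zero, Finset.sum_const_zero] at h1
  -- The dimension formula excludes an empty radical.
  have hc : 0 < (radical μ).card := by
    refine Nat.pos_of_ne_zero fun h2 => ?_
    have h3 := hD.finrank_sq_mul_card_radical hirr
    rw [h2, mul_zero] at h3
    exact Fintype.card_ne_zero h3.symm
  have hne := (Nat.mul_pos hc (Nat.mul_pos (Module.finrank_pos (R := ℂ) (M := V))
    (Module.finrank_pos (R := ℂ) (M := V')))).ne'
  have hne' : ((radical μ).card * (Module.finrank ℂ V * Module.finrank ℂ V') : ℂ) ≠ 0 := by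
    exact_mod_cast hne
  exact hne' h1.symm

end IsProjectiveRep

/-! ## Monomials of quantum tori -/

namespace QuantumTorus

/-- Nonzero scalars as units of an algebra. -/
def scalarUnit (A : Type*) [Semiring A] [Algebra ℂ A] : ℂˣ →* Aˣ :=
  Units.map (algebraMap ℂ A).toMonoidHom

section

variable {A : Type*} [Semiring A] [Algebra ℂ A] {q : ℂˣ}

theorem qpow_eq_scalarUnit (z : ℤ) : qpow q A z = scalarUnit A (q ^ z) := rfl

theorem scalarUnit_val (z : ℂˣ) : (scalarUnit A z : A) = algebraMap ℂ A z := rfl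

theorem scalarUnit_val_mul (z : ℂˣ) (u : Aˣ) :
    ((scalarUnit A z * u : Aˣ) : A) = (z : ℂ) • (u : A) := by
  rw [Units.val_mul, scalarUnit_val, Algebra.smul_def]

theorem map_scalarUnit {B : Type*} [Semiring B] [Algebra ℂ B] (φ : A →ₐ[ℂ] B) (z : ℂˣ) :
    Units.map (φ : A →* B) (scalarUnit A z) = scalarUnit B z := by
  ext
  exact φ.commutes z

theorem map_qpow {B : Type*} [Semiring B] [Algebra ℂ B] (φ : A →ₐ[ℂ] B) (z : ℤ) :
    Units.map (φ : A →* B) (qpow q A z) = qpow q B z :=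
  map_scalarUnit φ _

theorem QComm.zpow_zpow {u v : Aˣ} {z : ℤ} (h : QComm q u v z) (k l : ℤ) :
    QComm q (u ^ k) (v ^ l) (l * (k * z)) := by
  have := ((h.symm.zpow_right k).symm).zpow_right l
  simpa using this

/-- Reordering the product of two ordered products of powers. -/
theorem prod_ofFn_mul_prod_ofFn {n : ℕ} {σ : Fin n → Fin n → ℤ} (u : Fin n → Aˣ)
    (hu : ∀ i j, QComm q (u i) (u j) (2 * σ i j)) (k l : Fin n → ℤ) :
    (List.ofFn fun i => u i ^ k i).prod * (List.ofFn fun i => u i ^ l i).prod =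
      qpow q A (∑ i, ∑ j, if j < i then 2 * σ i j * k i * l j else 0) *
        (List.ofFn fun i => u i ^ (k i + l i)).prod := by
  induction n with
  | zero => simp [qpow_zero]
  | succ n ih =>
    simp only [List.ofFn_succ, List.prod_cons]
    have h1 := ih (σ := fun i j => σ i.succ j.succ) (fun i => u i.succ)
      (fun i j => hu i.succ j.succ) (fun i => k i.succ) (fun i => l i.succ)
    -- The only reordering involving index `0` moves `u 0 ^ l 0` left past the tail of the first
    -- product; the rest is the induction hypothesis.
    have h2 : QComm q (u 0 ^ l 0) (List.ofFn fun i : Fin n => u i.succ ^ k i.succ).prod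
        (∑ i : Fin n, k i.succ * (l 0 * -(2 * σ i.succ 0))) :=
      QComm.ofFn_right fun i => (hu i.succ 0).symm.zpow_zpow _ _
    have h3 := h2.symm
    unfold QComm at h3
    set Rk := (List.ofFn fun i : Fin n => u i.succ ^ k i.succ).prod
    set Rl := (List.ofFn fun i : Fin n => u i.succ ^ l i.succ).prod
    have h4 : u 0 ^ k 0 * Rk * (u 0 ^ l 0 * Rl) = u 0 ^ k 0 * (Rk * u 0 ^ l 0) * Rl := by
      simp only [mul_assoc]
    rw [h4, h3, ← mul_assoc (u 0 ^ k 0), ← qpow_comm]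
    have h5 : ∀ c : ℤ, qpow q A c * u 0 ^ k 0 * (u 0 ^ l 0 * Rk) * Rl =
        qpow q A c * (u 0 ^ (k 0 + l 0) * (Rk * Rl)) := by
      intro c
      rw [zpow_add]
      simp only [mul_assoc]
    rw [h5, h1, ← mul_assoc (u 0 ^ (k 0 + l 0)), ← qpow_comm, mul_assoc, ← mul_assoc,
      ← qpow_add]
    congr 2
    simp only [Fin.sum_univ_succ (n := n), Fin.not_lt_zero, if_false, Fin.succ_pos, if_true,
      Fin.succ_lt_succ_iff, Finset.sum_const_zero, lt_irrefl, zero_add, Finset.sum_add_distrib,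
      ← Finset.sum_neg_distrib]
    congr 1
    exact Finset.sum_congr rfl fun i _ => by ring

end

/-- The bilinear extension of the form `σ`. -/
def pairing {n : ℕ} (σ : Fin n → Fin n → ℤ) (k l : Fin n → ℤ) : ℤ :=
  ∑ j, l j * ∑ i, k i * σ i j

variable {n : ℕ} {σ : Fin n → Fin n → ℤ} {q : ℂˣ}

theorem pairing_smul_left (c : ℤ) (k l : Fin n → ℤ) :
    pairing σ (c • k) l = c * pairing σ k l := by
  simp only [pairing, Finset.mul_sum, Pi.smul_apply, smul_eq_mul]
  exact Finset.sum_congr rfl fun i _ => Finset.sum_congr rfl fun j _ => by ring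

theorem pairing_swap (hσ : ∀ i j, σ j i = -σ i j) (k l : Fin n → ℤ) :
    pairing σ l k = -pairing σ k l := by
  simp only [pairing, Finset.mul_sum, ← Finset.sum_neg_distrib]
  rw [Finset.sum_comm]
  exact Finset.sum_congr rfl fun i _ => Finset.sum_congr rfl fun j _ => by rw [hσ]; ring

theorem pairing_self (hσ : ∀ i j, σ j i = -σ i j) (k : Fin n → ℤ) : pairing σ k k = 0 := by
  have := pairing_swap hσ k k
  omega

/-- Reordering produces the phase `2 σ_ij k_i l_j` over `j < i`; the normalizing factors of the
three monomials antisymmetrize it into the full form. This is the purpose of the Weyl ordering. -/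
theorem monomial_mul (hσ : ∀ i j, σ j i = -σ i j) (k l : Fin n → ℤ) :
    monomial σ q k * monomial σ q l =
      qpow q (QuantumTorus σ q) (pairing σ k l) * monomial σ q (k + l) := by
  unfold monomial
  set c : (Fin n → ℤ) → ℤ := fun k => ∑ i, ∑ j, if i < j then σ i j * k i * k j else 0 with hc
  change qpow q _ (-c k) * _ * (qpow q _ (-c l) * _) = _ * (qpow q _ (-c (k + l)) * _)
  rw [mul_assoc, ← mul_assoc _ (qpow q _ (-c l)), ← qpow_comm, mul_assoc (qpow q _ (-c l)),
    prod_ofFn_mul_prod_ofFn (σ := σ) _ X_mul_X, ← mul_assoc, ← mul_assoc, ← mul_assoc, ← qpow_add,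
    ← qpow_add, ← qpow_add]
  congr 2
  -- Fold all double sums onto `i < j`, so that the exponents can be compared pair by pair; the
  -- diagonal drops out by antisymmetry.
  have h1 : ∀ f : Fin n → Fin n → ℤ, ∑ i, ∑ j, f i j =
      (∑ i, ∑ j, if i < j then f i j + f j i else 0) + ∑ i, f i i := by
    intro f
    have h2 : ∀ i j, f i j = (if i < j then f i j else 0) + (if j < i then f i j else 0) +
        if i = j then f i i else 0 := by
      intro i j
      rcases lt_trichotomy i j with h | h | h
      · simp [h, h.ne, h.not_gt]
      · simp [h]
      · simp [h, h.ne', h.not_gt]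
    have h3 : ∑ i, ∑ j, (if j < i then f i j else 0) = ∑ i, ∑ j, if i < j then f j i else 0 :=
      Finset.sum_comm
    rw [Finset.sum_congr rfl fun i _ => Finset.sum_congr rfl fun j _ => h2 i j]
    simp only [Finset.sum_add_distrib, h3, Finset.sum_ite_eq, Finset.mem_univ, if_true]
    rw [← Finset.sum_add_distrib]
    congr 1
    refine Finset.sum_congr rfl fun i _ => ?_
    rw [← Finset.sum_add_distrib]
    refine Finset.sum_congr rfl fun j _ => ?_
    split_ifs <;> simp
  have h4 : pairing σ k l = ∑ i, ∑ j, σ i j * k i * l j := by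
    simp only [pairing, Finset.mul_sum]
    rw [Finset.sum_comm]
    exact Finset.sum_congr rfl fun i _ => Finset.sum_congr rfl fun j _ => by ring
  have h5 : ∑ i, ∑ j, (if j < i then 2 * σ i j * k i * l j else 0) =
      ∑ i, ∑ j, if i < j then 2 * σ j i * k j * l i else 0 := Finset.sum_comm
  have h6 : ∀ i, σ i i = 0 := fun i => by have := hσ i i; omega
  rw [h4, h1 fun i j => σ i j * k i * l j, h5, hc]
  simp only [h6, zero_mul, Finset.sum_const_zero, add_zero, ← Finset.sum_neg_distrib,
    ← Finset.sum_add_distrib]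
  refine Finset.sum_congr rfl fun i _ => Finset.sum_congr rfl fun j _ => ?_
  split_ifs
  · rw [hσ i j, Pi.add_apply, Pi.add_apply]
    ring
  · simp

theorem monomial_zero : monomial σ q 0 = 1 := by
  simp [monomial, qpow_zero]

theorem prod_ofFn_single {M : Type*} [Monoid M] {n : ℕ} (u : Fin n → M) (i : Fin n)
    (hu : ∀ j, j ≠ i → u j = 1) : (List.ofFn u).prod = u i := by
  induction n with
  | zero => exact i.elim0
  | succ n ih =>
    rw [List.ofFn_succ, List.prod_cons]
    refine Fin.cases (fun hu => ?_) (fun i hu => ?_) i hu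
    · rw [List.prod_eq_one, mul_one]
      intro x hx
      obtain ⟨j, rfl⟩ := List.mem_ofFn.1 hx
      exact hu _ (Fin.succ_ne_zero j)
    · rw [ih _ i fun j hj => hu _ fun h => hj (Fin.succ_injective _ h),
        hu 0 (Fin.succ_ne_zero i).symm, one_mul]

theorem monomial_single (i : Fin n) (c : ℤ) :
    monomial σ q (Pi.single i c) = X σ q i ^ c := by
  unfold monomial
  rw [prod_ofFn_single _ i fun j hj => by simp [Pi.single_eq_of_ne hj], Pi.single_eq_same]
  have h1 : ∀ i' j, (if i' < j then σ i' j * Pi.single (M := fun _ => ℤ) i c i' *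
      Pi.single (M := fun _ => ℤ) i c j else 0) = 0 := by
    intro i' j
    split_ifs with h
    · by_cases h1 : i' = i
      · have h2 : j ≠ i := fun h2 => by rw [h1, h2] at h; exact lt_irrefl _ h
        simp [Pi.single_eq_of_ne h2]
      · simp [Pi.single_eq_of_ne h1]
    · rfl
  simp only [h1, Finset.sum_const_zero, neg_zero, qpow_zero, one_mul]

theorem monomial_pow (hσ : ∀ i j, σ j i = -σ i j) (k : Fin n → ℤ) (a : ℕ) :
    monomial σ q k ^ a = monomial σ q ((a : ℤ) • k) := by
  induction a with
  | zero => simp [monomial_zero]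
  | succ a ih =>
    rw [pow_succ, ih, monomial_mul hσ, pairing_smul_left, pairing_self hσ, mul_zero, qpow_zero,
      one_mul]
    congr 1
    push_cast
    rw [add_smul, one_smul]

/-- A subalgebra of a quantum torus that contains all monomials is everything. -/
theorem subalgebra_eq_top (S : Subalgebra ℂ (QuantumTorus σ q))
    (hS : ∀ k, (monomial σ q k : QuantumTorus σ q) ∈ S) : S = ⊤ := by
  rw [eq_top_iff]
  rintro a -
  obtain ⟨a, rfl⟩ := RingQuot.mkAlgHom_surjective ℂ (Rel σ q) a
  induction a using FreeAlgebra.induction with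
  | grade0 r => rw [AlgHom.commutes]; exact S.algebraMap_mem r
  | grade1 i =>
    rcases i with i | i
    · have h := hS (Pi.single i 1)
      rw [monomial_single, zpow_one] at h
      exact h
    · have h := hS (Pi.single i (-1))
      rw [monomial_single, zpow_neg, zpow_one] at h
      exact h
  | mul a b ha hb => rw [map_mul]; exact S.mul_mem ha hb
  | add a b ha hb => rw [map_add]; exact S.add_mem ha hb

end QuantumTorus

/-! ## Representations of quantum tori at roots of unity -/

namespace QuantumTorus

variable {n : ℕ} {σ : Fin n → Fin n → ℤ} {q : ℂˣ} {N : ℕ}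

section

variable {B : Type*} [Semiring B] [Algebra ℂ B] (φ : QuantumTorus σ q →ₐ[ℂ] B) {x : Fin n → ℂˣ}

/-- The image of a monomial. -/
def mapMonomial (k : Fin n → ℤ) : Bˣ := Units.map (φ : QuantumTorus σ q →* B) (monomial σ q k)

theorem mapMonomial_val (k : Fin n → ℤ) :
    (mapMonomial φ k : B) = φ (monomial σ q k : QuantumTorus σ q) := rfl

theorem mapMonomial_mul (hσ : ∀ i j, σ j i = -σ i j) (k l : Fin n → ℤ) :
    mapMonomial φ k * mapMonomial φ l =
      scalarUnit B (q ^ pairing σ k l) * mapMonomial φ (k + l) := by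
  unfold mapMonomial
  rw [← map_mul, monomial_mul hσ, map_mul, map_qpow, qpow_eq_scalarUnit]

theorem qpow_mul_eq_one (hq : q ^ N = 1) (z : ℤ) : q ^ ((N : ℤ) * z) = 1 := by
  rw [zpow_mul, zpow_natCast, hq, one_zpow]

/-- The normalizing exponent is a multiple of `N`, so its phase is trivial and only powers of the
weights remain. -/
theorem mapMonomial_smul (hq : q ^ N = 1)
    (hx : ∀ i, φ ((X σ q i : QuantumTorus σ q) ^ N) = algebraMap ℂ B (x i)) (l : Fin n → ℤ) :
    mapMonomial φ ((N : ℤ) • l) = scalarUnit B (∏ i, x i ^ l i) := by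
  have hx' : ∀ i, Units.map (φ : QuantumTorus σ q →* B) (X σ q i) ^ N = scalarUnit B (x i) := by
    intro i
    ext
    simpa [scalarUnit_val] using hx i
  have h1 : ∑ i, ∑ j, (if i < j then σ i j * ((N : ℤ) • l) i * ((N : ℤ) • l) j else 0) =
      (N : ℤ) * ∑ i, ∑ j, (if i < j then σ i j * l i * ((N : ℤ) • l) j else 0) := by
    simp only [Finset.mul_sum, Pi.smul_apply, smul_eq_mul]
    refine Finset.sum_congr rfl fun i _ => Finset.sum_congr rfl fun j _ => ?_
    split_ifs
    · ring
    · simp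
  unfold mapMonomial monomial
  rw [h1, map_mul, map_qpow, qpow_eq_scalarUnit, ← mul_neg, qpow_mul_eq_one hq, map_one, one_mul,
    map_list_prod, List.map_ofFn, ← List.prod_ofFn, map_list_prod, List.map_ofFn]
  congr 2
  funext i
  simp only [Function.comp_apply, Pi.smul_apply, smul_eq_mul, map_zpow]
  rw [zpow_mul, zpow_natCast, hx']

theorem mapMonomial_add_smul (hσ : ∀ i j, σ j i = -σ i j) (hq : q ^ N = 1)
    (hx : ∀ i, φ ((X σ q i : QuantumTorus σ q) ^ N) = algebraMap ℂ B (x i)) (k l : Fin n → ℤ) :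
    mapMonomial φ (k + (N : ℤ) • l) = scalarUnit B (∏ i, x i ^ l i) * mapMonomial φ k := by
  have h := mapMonomial_mul φ hσ ((N : ℤ) • l) k
  rw [pairing_smul_left, qpow_mul_eq_one hq, map_one, one_mul, mapMonomial_smul φ hq hx,
    add_comm] at h
  exact h.symm

end

/-- Representatives of residue classes. -/
def residueLift (g : Fin n → ZMod N) (i : Fin n) : ℤ := (g i).val

theorem intCast_residueLift [NeZero N] (g : Fin n → ZMod N) (i : Fin n) :
    ((residueLift g i : ℤ) : ZMod N) = g i := by
  simp [residueLift]

theorem exists_eq_add_smul (k l : Fin n → ℤ) (h : ∀ i, (k i : ZMod N) = l i) :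
    k = l + (N : ℤ) • fun i => (k i - l i) / N := by
  funext i
  have h1 : (N : ℤ) ∣ k i - l i := by
    rw [← ZMod.intCast_zmod_eq_zero_iff_dvd]
    push_cast
    rw [h i, sub_self]
  simp [Int.mul_ediv_cancel' h1]

/-- The multiplier of the projective representations of `(ℤ/N)^n` defined by representations of
the quantum torus with weights `x`. -/
def multiplier (σ : Fin n → Fin n → ℤ) (q : ℂˣ) (N : ℕ) (x : Fin n → ℂˣ)
    (g h : Fin n → ZMod N) : ℂ :=
  ((q ^ pairing σ (residueLift g) (residueLift h) *
    ∏ i, x i ^ ((residueLift g i + residueLift h i - residueLift (g + h) i) / N) : ℂˣ) : ℂ)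

variable {V : Type*} [AddCommGroup V] [Module ℂ V] (ρ : QuantumTorus σ q →ₐ[ℂ] Module.End ℂ V)
  {x : Fin n → ℂˣ}

/-- The operators that represent residue classes of multi-indices. -/
def residueOp (g : Fin n → ZMod N) : (Module.End ℂ V)ˣ := mapMonomial ρ (residueLift g)

theorem isProjectiveRep_residueOp [NeZero N] (hσ : ∀ i j, σ j i = -σ i j) (hq : q ^ N = 1)
    (hx : ∀ i, ρ ((X σ q i : QuantumTorus σ q) ^ N) = algebraMap ℂ _ (x i : ℂ)) :
    IsProjectiveRep (multiplier σ q N x) (residueOp ρ) where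
  mul g h := by
    have h1 := exists_eq_add_smul (N := N) (residueLift g + residueLift h) (residueLift (g + h))
      fun i => by simp [intCast_residueLift]
    have h2 := mapMonomial_mul ρ hσ (residueLift g) (residueLift h)
    rw [h1, mapMonomial_add_smul ρ hσ hq hx, ← mul_assoc, ← map_mul] at h2
    have h3 := congrArg Units.val h2
    rw [scalarUnit_val_mul, Units.val_mul] at h3
    exact h3
  ne_zero g h := Units.ne_zero _

theorem mapMonomial_eq_smul_residueOp [NeZero N] (hσ : ∀ i j, σ j i = -σ i j) (hq : q ^ N = 1)
    (hx : ∀ i, ρ ((X σ q i : QuantumTorus σ q) ^ N) = algebraMap ℂ _ (x i : ℂ)) (k : Fin n → ℤ) :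
    (mapMonomial ρ k : Module.End ℂ V) =
      ((∏ i, x i ^ ((k i - residueLift (N := N) (fun i => (k i : ZMod N)) i) / N) : ℂˣ) : ℂ) •
        (residueOp ρ (fun i => (k i : ZMod N)) : Module.End ℂ V) := by
  have h1 := exists_eq_add_smul (N := N) k (residueLift (N := N) fun i => (k i : ZMod N))
    fun i => by simp [intCast_residueLift]
  conv_lhs => rw [h1]
  rw [mapMonomial_add_smul ρ hσ hq hx, scalarUnit_val_mul]
  rfl

theorem apply_mem_of_mapMonomial_mem (U : Submodule ℂ V)
    (hU : ∀ k, ∀ u ∈ U, (mapMonomial ρ k : Module.End ℂ V) u ∈ U)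
    (a : QuantumTorus σ q) : ∀ u ∈ U, ρ a u ∈ U := by
  let S : Subalgebra ℂ (QuantumTorus σ q) :=
    { carrier := {a | ∀ u ∈ U, ρ a u ∈ U}
      mul_mem' := fun {a b} ha hb u hu => by
        rw [map_mul]
        exact ha _ (hb u hu)
      add_mem' := fun {a b} ha hb u hu => by
        rw [map_add]
        exact U.add_mem (ha u hu) (hb u hu)
      algebraMap_mem' := fun r u hu => by
        rw [AlgHom.commutes]
        exact U.smul_mem r hu }
  have hS : S = ⊤ := subalgebra_eq_top S hU
  have : a ∈ S := hS ▸ Algebra.mem_top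
  exact this

theorem apply_mem_of_residueOp_mem [NeZero N] (hσ : ∀ i j, σ j i = -σ i j) (hq : q ^ N = 1)
    (hx : ∀ i, ρ ((X σ q i : QuantumTorus σ q) ^ N) = algebraMap ℂ _ (x i : ℂ))
    (U : Submodule ℂ V)
    (hU : ∀ g : Fin n → ZMod N, ∀ u ∈ U, (residueOp ρ g : Module.End ℂ V) u ∈ U)
    (a : QuantumTorus σ q) : ∀ u ∈ U, ρ a u ∈ U :=
  apply_mem_of_mapMonomial_mem ρ U (fun k u hu => by
    rw [mapMonomial_eq_smul_residueOp ρ hσ hq hx k]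
    exact U.smul_mem _ (hU _ u hu)) a

theorem isIrreducibleFamily_residueOp [NeZero N] (hσ : ∀ i j, σ j i = -σ i j) (hq : q ^ N = 1)
    (hx : ∀ i, ρ ((X σ q i : QuantumTorus σ q) ^ N) = algebraMap ℂ _ (x i : ℂ))
    (hρ : IsIrreducibleRep ρ) :
    IsIrreducibleFamily fun g : Fin n → ZMod N => (residueOp ρ g : Module.End ℂ V) :=
  ⟨hρ.1, fun U hU => hρ.2 U (apply_mem_of_residueOp_mem ρ hσ hq hx U hU)⟩

theorem repIso_of_residueOp [NeZero N] {V' : Type*} [AddCommGroup V'] [Module ℂ V']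
    (ρ' : QuantumTorus σ q →ₐ[ℂ] Module.End ℂ V') (hσ : ∀ i j, σ j i = -σ i j) (hq : q ^ N = 1)
    (hx : ∀ i, ρ ((X σ q i : QuantumTorus σ q) ^ N) = algebraMap ℂ _ (x i : ℂ))
    (hx' : ∀ i, ρ' ((X σ q i : QuantumTorus σ q) ^ N) = algebraMap ℂ _ (x i : ℂ))
    (L : V ≃ₗ[ℂ] V') (hL : ∀ (g : Fin n → ZMod N) v, L ((residueOp ρ g : Module.End ℂ V) v) =
      (residueOp ρ' g : Module.End ℂ V') (L v)) : RepIso ρ ρ' := by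
  refine ⟨L, fun a => ?_⟩
  let S : Subalgebra ℂ (QuantumTorus σ q) :=
    { carrier := {a | ∀ v, L (ρ a v) = ρ' a (L v)}
      mul_mem' := fun {a b} ha hb u => by
        rw [map_mul, map_mul, Module.End.mul_apply, Module.End.mul_apply, ha, hb]
      add_mem' := fun {a b} ha hb u => by
        rw [map_add, map_add, LinearMap.add_apply, LinearMap.add_apply, map_add, ha, hb]
      algebraMap_mem' := fun r u => by
        rw [AlgHom.commutes, AlgHom.commutes]
        exact map_smul L r u }
  have hS : S = ⊤ := subalgebra_eq_top S fun k u => by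
    rw [← mapMonomial_val, ← mapMonomial_val, mapMonomial_eq_smul_residueOp ρ hσ hq hx k,
      mapMonomial_eq_smul_residueOp ρ' hσ hq hx' k, LinearMap.smul_apply, LinearMap.smul_apply,
      map_smul, hL]
  have : a ∈ S := hS ▸ Algebra.mem_top
  exact this

theorem intCast_pairing_residueLift [NeZero N] (g h : Fin n → ZMod N) :
    ((pairing σ (residueLift g) (residueLift h) : ℤ) : ZMod N) =
      ∑ j, h j * ∑ i, g i * (σ i j : ZMod N) := by
  simp [pairing, intCast_residueLift]

/-- The weight factors of the multiplier are symmetric in `g` and `h`, so commutation means that `q`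
to twice the pairing is `1`. Oddness of `N` removes the factor `2`. -/
theorem mem_radical_multiplier_iff [NeZero N] (hσ : ∀ i j, σ j i = -σ i j) (hN : Odd N)
    (hq : IsPrimitiveRoot q N) (g : Fin n → ZMod N) :
    g ∈ IsProjectiveRep.radical (multiplier σ q N x) ↔
      ∀ j, ∑ i, g i * (σ i j : ZMod N) = 0 := by
  have h1 : ∀ h, multiplier σ q N x g h = multiplier σ q N x h g ↔
      ∑ j, h j * ∑ i, g i * (σ i j : ZMod N) = 0 := by
    intro h
    have h2 : ∀ i, residueLift g i + residueLift h i - residueLift (g + h) i =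
        residueLift h i + residueLift g i - residueLift (h + g) i := by
      intro i
      rw [add_comm g h, add_comm (residueLift g i)]
    unfold multiplier
    simp only [h2]
    rw [Units.val_inj, mul_left_inj, pairing_swap hσ (residueLift g) (residueLift h),
      ← intCast_pairing_residueLift, ZMod.intCast_zmod_eq_zero_iff_dvd, zpow_neg,
      ← mul_eq_one_iff_eq_inv, ← zpow_add, hq.zpow_eq_one_iff_dvd, ← two_mul]
    refine ⟨fun h => IsCoprime.dvd_of_dvd_mul_left ?_ h, fun h => h.mul_left 2⟩
    exact_mod_cast Nat.isCoprime_iff_coprime.2 hN.coprime_two_right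
  rw [IsProjectiveRep.mem_radical]
  simp only [h1]
  constructor
  · intro h j
    simpa [Pi.single_apply] using h (Pi.single j 1)
  · intro h l
    simp [h]

end QuantumTorus

/-! ## Decomposition into irreducible representations -/

section Decomposition

variable {A : Type*} [Semiring A] [Algebra ℂ A] {V : Type*} [AddCommGroup V] [Module ℂ V]

theorem subRep_apply_coe (ρ : A →ₐ[ℂ] Module.End ℂ V) (U : Submodule ℂ V)
    (hU : ∀ a : A, ∀ u ∈ U, ρ a u ∈ U) (a : A) (u : U) :
    ((subRep ρ U hU a u : U) : V) = ρ a u := rfl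

theorem subRep_eq_smul_one (ρ : A →ₐ[ℂ] Module.End ℂ V) (U : Submodule ℂ V)
    (hU : ∀ a : A, ∀ u ∈ U, ρ a u ∈ U) {a : A} {z : ℂ} (h : ρ a = z • 1) :
    subRep ρ U hU a = z • 1 := by
  ext u
  rw [subRep_apply_coe, h]
  rfl

/-- A finite-dimensional representation in which invariant subspaces have invariant complements
is a finite direct sum of irreducible representations. -/
theorem exists_isInternal_irreducible [FiniteDimensional ℂ V] (ρ : A →ₐ[ℂ] Module.End ℂ V)
    (h : ∀ U : Submodule ℂ V, (∀ a, ∀ u ∈ U, ρ a u ∈ U) →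
      ∃ U' : Submodule ℂ V, (∀ a, ∀ u ∈ U', ρ a u ∈ U') ∧ IsCompl U U') :
    ∃ (r : ℕ) (U : Fin r → Submodule ℂ V) (hU : ∀ i, ∀ a, ∀ u ∈ U i, ρ a u ∈ U i),
      DirectSum.IsInternal U ∧ ∀ i, IsIrreducibleRep (subRep ρ (U i) (hU i)) := by
  -- Viewing `V` as an `A`-module identifies invariant subspaces with submodules, which reduces the
  -- claim to the theory of semisimple modules.
  let _ : Ring A := Algebra.semiringToRing ℂ
  let _ : Module A V := Module.compHom V (ρ : A →+* Module.End ℂ V)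
  have hsmul : ∀ (a : A) (v : V), a • v = ρ a v := fun _ _ => rfl
  have : IsScalarTower ℂ A V := ⟨fun z a v => by
    rw [hsmul, hsmul, map_smul, LinearMap.smul_apply]⟩
  let lft : ∀ U : Submodule ℂ V, (∀ a, ∀ u ∈ U, ρ a u ∈ U) → Submodule A V := fun U hU =>
    { U.toAddSubmonoid with smul_mem' := hU }
  have hinv : ∀ M : Submodule A V, ∀ a, ∀ u ∈ M.restrictScalars ℂ,
      ρ a u ∈ M.restrictScalars ℂ := fun M a u hu => M.smul_mem a hu
  have : IsSemisimpleModule A V := by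
    refine (isSemisimpleModule_iff A V).2 ⟨fun M => ?_⟩
    obtain ⟨U', hU', hc⟩ := h (M.restrictScalars ℂ) (hinv M)
    refine ⟨lft U' hU', ?_, ?_⟩
    · rw [Submodule.disjoint_def]
      exact fun v hv hv' => Submodule.disjoint_def.1 hc.1 v hv hv'
    · rw [codisjoint_iff, eq_top_iff]
      intro v _
      obtain ⟨y, hy, z, hz, hyz⟩ := Submodule.mem_sup.1
        (show v ∈ M.restrictScalars ℂ ⊔ U' from codisjoint_iff.1 hc.2 ▸ Submodule.mem_top)
      exact Submodule.mem_sup.2 ⟨y, hy, z, hz, hyz⟩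
  obtain ⟨S, hind, hsup, hsimple⟩ := IsSemisimpleModule.exists_sSupIndep_sSup_simples_eq_top A V
  have hind' : iSupIndep fun M : S => ((M : Submodule A V).restrictScalars ℂ) := by
    intro M
    have h1 := (sSupIndep_iff S).1 hind M
    rw [Submodule.disjoint_def] at h1 ⊢
    simp only [← Submodule.restrictScalars_iSup]
    exact h1
  have : IsNoetherian A V := isNoetherian_of_tower ℂ inferInstance
  have : Finite S := WellFoundedGT.finite_of_sSupIndep hind
  obtain ⟨r, ⟨e⟩⟩ := Finite.exists_equiv_fin S
  refine ⟨r, fun i => ((e.symm i : S) : Submodule A V).restrictScalars ℂ, fun i => hinv _, ?_, ?_⟩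
  · refine DirectSum.isInternal_submodule_of_iSupIndep_of_iSup_eq_top
      (hind'.comp e.symm.injective) ?_
    rw [← Submodule.restrictScalars_iSup, e.symm.iSup_comp (g := fun M : S => (M : Submodule A V)),
      ← sSup_eq_iSup', hsup, Submodule.restrictScalars_top]
  · intro i
    have hs := hsimple _ (e.symm i).2
    constructor
    · have := IsSimpleModule.nontrivial A ((e.symm i : S) : Submodule A V)
      exact this
    · intro U hU
      let M : Submodule A ((e.symm i : S) : Submodule A V) :=
        { carrier := {u | u ∈ U}
          add_mem' := U.add_mem
          zero_mem' := U.zero_mem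
          smul_mem' := hU }
      rcases hs.1.eq_bot_or_eq_top M with h1 | h1
      · exact Or.inl ((Submodule.eq_bot_iff _).2 fun u hu => (Submodule.eq_bot_iff _).1 h1 u hu)
      · refine Or.inr (eq_top_iff.2 fun u _ => ?_)
        exact (Submodule.eq_top_iff'.1 h1) u

end Decomposition

namespace QuantumTorus

variable {n : ℕ} {σ : Fin n → Fin n → ℤ} {q : ℂˣ} {N : ℕ}
  {V : Type*} [AddCommGroup V] [Module ℂ V]

/-- `X_i ^ N` commutes with all monomials because `q ^ N = 1`; Schur's lemma makes it a scalar,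
nonzero because it is invertible. -/
theorem exists_weights_of_irreducible (ρ : QuantumTorus σ q →ₐ[ℂ] Module.End ℂ V)
    [FiniteDimensional ℂ V] (hq : q ^ N = 1) (hρ : IsIrreducibleRep ρ) :
    ∃ x : Fin n → ℂˣ,
      ∀ i, ρ ((X σ q i : QuantumTorus σ q) ^ N) = algebraMap ℂ _ (x i : ℂ) := by
  have h1 : ∀ i, ∃ z : ℂˣ, ρ ((X σ q i : QuantumTorus σ q) ^ N) = algebraMap ℂ _ (z : ℂ) := by
    intro i
    have hirr : IsIrreducibleFamily fun k => (mapMonomial ρ k : Module.End ℂ V) :=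
      ⟨hρ.1, fun U hU => hρ.2 U (apply_mem_of_mapMonomial_mem ρ U hU)⟩
    have hc : ∀ k, X σ q i ^ N * monomial σ q k = monomial σ q k * X σ q i ^ N := by
      intro k
      have h2 : QComm q (monomial σ q k) (X σ q i) (-∑ j, k j * (2 * σ i j)) :=
        (QComm.monomial_right (fun j => X_mul_X i j) k).symm
      have h3 := h2.zpow_right N
      unfold QComm at h3
      rw [qpow_eq_scalarUnit, qpow_mul_eq_one hq, map_one, one_mul, zpow_natCast] at h3
      exact h3.symm
    obtain ⟨z, hz⟩ := hirr.exists_eq_smul_one (ρ ((X σ q i : QuantumTorus σ q) ^ N)) fun k => by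
      have := congrArg Units.val (hc k)
      rw [Units.val_mul, Units.val_mul, Units.val_pow_eq_pow_val] at this
      rw [mapMonomial_val, ← map_mul, ← map_mul, this]
    have hz0 : z ≠ 0 := by
      rintro rfl
      have := hρ.1
      have hu : IsUnit (ρ ((X σ q i : QuantumTorus σ q) ^ N)) :=
        ((X σ q i).isUnit.pow N).map ρ
      rw [hz, zero_smul] at hu
      exact not_isUnit_zero hu
    exact ⟨Units.mk0 z hz0, by rw [hz, Units.val_mk0, Algebra.algebraMap_eq_smul_one]⟩
  exact ⟨fun i => (h1 i).choose, fun i => (h1 i).choose_spec⟩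

/-- A representation with weights is a direct sum of irreducible representations. -/
theorem exists_isInternal_irreducible [FiniteDimensional ℂ V] [NeZero N]
    (ρ : QuantumTorus σ q →ₐ[ℂ] Module.End ℂ V) (hσ : ∀ i j, σ j i = -σ i j) (hq : q ^ N = 1)
    {x : Fin n → ℂˣ}
    (hx : ∀ i, ρ ((X σ q i : QuantumTorus σ q) ^ N) = algebraMap ℂ _ (x i : ℂ)) :
    ∃ (r : ℕ) (U : Fin r → Submodule ℂ V) (hU : ∀ i, ∀ a, ∀ u ∈ U i, ρ a u ∈ U i),
      DirectSum.IsInternal U ∧ ∀ i, IsIrreducibleRep (subRep ρ (U i) (hU i)) := by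
  refine _root_.exists_isInternal_irreducible ρ fun U hU => ?_
  obtain ⟨U', hU', hc⟩ := (isProjectiveRep_residueOp (N := N) ρ hσ hq hx).exists_isCompl U
    (fun g u hu => hU _ u hu) (fun g u hu => by
      -- Inverses of the operators are again images of algebra elements, so invariance under `ρ`
      -- covers them.
      have : (((residueOp ρ g)⁻¹ : (Module.End ℂ V)ˣ) : Module.End ℂ V) =
          ρ (((monomial σ q (residueLift g))⁻¹ : (QuantumTorus σ q)ˣ) : QuantumTorus σ q) := by
        unfold residueOp mapMonomial
        rw [← map_inv]
        rfl
      rw [this]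
      exact hU _ u hu)
  exact ⟨U', apply_mem_of_residueOp_mem ρ hσ hq hx U' hU', hc⟩

theorem finrank_sq_mul_card_radical [FiniteDimensional ℂ V] [NeZero N]
    (ρ : QuantumTorus σ q →ₐ[ℂ] Module.End ℂ V) (hσ : ∀ i j, σ j i = -σ i j) (hN : Odd N)
    (hq : IsPrimitiveRoot q N) (hρ : IsIrreducibleRep ρ) :
    Module.finrank ℂ V ^ 2 *
      Nat.card {g : Fin n → ZMod N // ∀ j, ∑ i, g i * (σ i j : ZMod N) = 0} = N ^ n := by
  obtain ⟨x, hx⟩ := exists_weights_of_irreducible ρ hq.pow_eq_one hρ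
  have h1 := (isProjectiveRep_residueOp (N := N) ρ hσ hq.pow_eq_one hx).finrank_sq_mul_card_radical
    (isIrreducibleFamily_residueOp ρ hσ hq.pow_eq_one hx hρ)
  rw [Fintype.card_pi_const, ZMod.card] at h1
  rw [← h1, ← Nat.card_eq_finsetCard]
  congr 1
  exact Nat.card_congr (Equiv.subtypeEquivRight fun g => (mem_radical_multiplier_iff hσ hN hq g).symm)

end QuantumTorus

/-! ## Combinatorics of ideal triangulations -/

theorem nextSide_nextSide_nextSide {m : ℕ} (d : Fin m × Fin 3) :
    nextSide (nextSide (nextSide d)) = d := by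
  obtain ⟨t, i⟩ := d
  have : i + 1 + 1 + 1 = i := by
    rw [add_assoc, add_assoc]
    exact add_zero i
  simp [nextSide, this]

/-- The rotation of the sides of the triangles. -/
def nextSideEquiv (m : ℕ) : Fin m × Fin 3 ≃ Fin m × Fin 3 where
  toFun := nextSide
  invFun d := nextSide (nextSide d)
  left_inv := nextSide_nextSide_nextSide
  right_inv := nextSide_nextSide_nextSide

namespace IdealTriangulation

variable {m n s : ℕ} (T : IdealTriangulation m n s)

theorem edge_opp (d : Fin m × Fin 3) : T.edge (T.opp d) = T.edge d :=
  ((T.edge_eq_iff _ _).2 (Or.inr rfl)).symm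

theorem puncture_opp_nextSide (d : Fin m × Fin 3) :
    T.puncture (T.opp (nextSide d)) = T.puncture d :=
  ((T.puncture_eq_iff _ _).2 (Relation.EqvGen.rel _ _ rfl)).symm

theorem puncture_opp (d : Fin m × Fin 3) :
    T.puncture (T.opp d) = T.puncture (nextSide (nextSide d)) := by
  rw [← T.puncture_opp_nextSide (nextSide (nextSide d)), nextSide_nextSide_nextSide]

theorem puncture_nextSide_nextSide_opp (d : Fin m × Fin 3) :
    T.puncture (nextSide (nextSide (T.opp d))) = T.puncture d := by
  rw [← puncture_opp, T.opp_opp]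

theorem filter_edge_eq (d : Fin m × Fin 3) :
    (Finset.univ.filter fun d' => T.edge d' = T.edge d) = {d, T.opp d} := by
  ext d'
  simp only [Finset.mem_filter, Finset.mem_univ, true_and, Finset.mem_insert,
    Finset.mem_singleton]
  rw [eq_comm, T.edge_eq_iff]

theorem form_swap (i j : Fin n) : T.form j i = -T.form i j := by
  simp [form]

/-! ### The kernel of the form `σ` and the puncture multi-indices. -/

section

variable {R : Type*} [CommRing R]

theorem sum_ite_edge_eq (F : Fin m × Fin 3 → R) (d : Fin m × Fin 3) :
    ∑ d', (if T.edge d' = T.edge d then F d' else 0) = F d + F (T.opp d) := by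
  rw [← Finset.sum_filter, filter_edge_eq, Finset.sum_pair (T.opp_ne d).symm]

theorem sum_mul_sectors (k : Fin n → R) (d : Fin m × Fin 3) :
    ∑ i, k i * (T.sectors i (T.edge d) : R) =
      k (T.edge (nextSide (nextSide d))) + k (T.edge (nextSide (nextSide (T.opp d)))) := by
  have h1 : ∀ i, k i * (T.sectors i (T.edge d) : R) =
      ∑ d', if T.edge (nextSide d') = T.edge d then (if T.edge d' = i then k i else 0) else 0 := by
    intro i
    rw [sectors, Finset.card_filter, Nat.cast_sum, Finset.mul_sum]
    refine Finset.sum_congr rfl fun d' _ => ?_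
    split_ifs <;> simp_all
  rw [Finset.sum_congr rfl fun i _ => h1 i, Finset.sum_comm]
  have h2 : ∀ d', ∑ i, (if T.edge (nextSide d') = T.edge d then
      (if T.edge d' = i then k i else 0) else 0) =
      if T.edge (nextSide d') = T.edge d then
        k (T.edge (nextSide (nextSide (nextSide d')))) else 0 := by
    intro d'
    rw [nextSide_nextSide_nextSide]
    split_ifs <;> simp
  rw [Finset.sum_congr rfl fun d' _ => h2 d']
  -- Rotating the sides moves the condition from `nextSide d'` to `d'`, so that the sum runs over
  -- the two sides on the edge.
  exact (Equiv.sum_comp (nextSideEquiv m) fun d' => if T.edge d' = T.edge d then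
    k (T.edge (nextSide (nextSide d'))) else 0).trans
    (T.sum_ite_edge_eq (fun d' => k (T.edge (nextSide (nextSide d')))) d)

theorem sum_mul_sectors' (k : Fin n → R) (d : Fin m × Fin 3) :
    ∑ i, k i * (T.sectors (T.edge d) i : R) =
      k (T.edge (nextSide d)) + k (T.edge (nextSide (T.opp d))) := by
  have h1 : ∀ i, k i * (T.sectors (T.edge d) i : R) =
      ∑ d', if T.edge d' = T.edge d then (if T.edge (nextSide d') = i then k i else 0) else 0 := by
    intro i
    rw [sectors, Finset.card_filter, Nat.cast_sum, Finset.mul_sum]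
    refine Finset.sum_congr rfl fun d' _ => ?_
    split_ifs <;> simp_all
  rw [Finset.sum_congr rfl fun i _ => h1 i, Finset.sum_comm,
    ← T.sum_ite_edge_eq (fun d' => k (T.edge (nextSide d'))) d]
  refine Finset.sum_congr rfl fun d' _ => ?_
  split_ifs <;> simp

/-- Only the four sides of the quadrilateral around an edge contribute. This local formula reduces
the kernel of `σ` to conditions on pairs of adjacent faces. -/
theorem sum_mul_form (k : Fin n → R) (d : Fin m × Fin 3) :
    ∑ i, k i * (T.form i (T.edge d) : R) =
      k (T.edge (nextSide (nextSide d))) + k (T.edge (nextSide (nextSide (T.opp d)))) -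
        (k (T.edge (nextSide d)) + k (T.edge (nextSide (T.opp d)))) := by
  rw [← sum_mul_sectors, ← sum_mul_sectors', ← Finset.sum_sub_distrib]
  refine Finset.sum_congr rfl fun i _ => ?_
  simp [form, mul_sub]

/-- The combination of the multi-indices of the puncture invariants. -/
def crossingSum (a : Fin s → R) (i : Fin n) : R := ∑ v, a v * (T.crossings v i : R)

/-- An edge is crossed once near each of its two ends, so its exponent is the sum of the values of
`a` at the ends, which may be the same puncture. -/
theorem crossingSum_edge (a : Fin s → R) (d : Fin m × Fin 3) :
    T.crossingSum a (T.edge d) = a (T.puncture d) + a (T.puncture (nextSide (nextSide d))) := by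
  have h1 : ∀ v, a v * (T.crossings v (T.edge d) : R) =
      ∑ d', if T.edge (nextSide d') = T.edge d then (if T.puncture d' = v then a v else 0)
        else 0 := by
    intro i
    rw [crossings, Finset.card_filter, Nat.cast_sum, Finset.mul_sum]
    refine Finset.sum_congr rfl fun d' _ => ?_
    split_ifs <;> simp_all
  unfold crossingSum
  rw [Finset.sum_congr rfl fun i _ => h1 i, Finset.sum_comm]
  have h2 : ∀ d', ∑ v, (if T.edge (nextSide d') = T.edge d then
      (if T.puncture d' = v then a v else 0) else 0) =
      if T.edge (nextSide d') = T.edge d then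
        a (T.puncture (nextSide (nextSide (nextSide d')))) else 0 := by
    intro d'
    rw [nextSide_nextSide_nextSide]
    split_ifs <;> simp
  rw [Finset.sum_congr rfl fun d' _ => h2 d']
  refine (Equiv.sum_comp (nextSideEquiv m) fun d' => if T.edge d' = T.edge d then
    a (T.puncture (nextSide (nextSide d'))) else 0).trans
    ((T.sum_ite_edge_eq (fun d' => a (T.puncture (nextSide (nextSide d')))) d).trans ?_)
  rw [puncture_nextSide_nextSide_opp, add_comm]

/-- Written as sums over end points, the contributions of opposite sides of the quadrilateral around
an edge involve the same four punctures and cancel. -/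
theorem sum_crossingSum_mul_form (a : Fin s → R) (j : Fin n) :
    ∑ i, T.crossingSum a i * (T.form i j : R) = 0 := by
  obtain ⟨d, rfl⟩ := T.edge_surjective j
  rw [sum_mul_form]
  simp only [crossingSum_edge, nextSide_nextSide_nextSide, puncture_nextSide_nextSide_opp,
    puncture_opp]
  ring

/-- Within one face the edge sums can be solved for the value at a corner, up to the factor `2`. -/
theorem crossingSum_corner (a : Fin s → R) (d : Fin m × Fin 3) :
    T.crossingSum a (T.edge d) + T.crossingSum a (T.edge (nextSide d)) -
      T.crossingSum a (T.edge (nextSide (nextSide d))) = 2 * a (T.puncture d) := by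
  simp only [crossingSum_edge, nextSide_nextSide_nextSide]
  ring

theorem crossingSum_injective (h2 : IsUnit (2 : R)) :
    Function.Injective (T.crossingSum (R := R)) := by
  intro a b hab
  funext v
  obtain ⟨d, rfl⟩ := T.puncture_surjective v
  refine h2.mul_left_cancel ?_
  rw [← crossingSum_corner, ← crossingSum_corner, hab]

/-- The corner formula dictates the value to put at each corner. The kernel equation at an edge says
exactly that this value survives crossing the edge around a puncture, so it descends to punctures;
the two corners along a side then add up to `k`. -/
theorem exists_crossingSum_eq (h2 : IsUnit (2 : R)) (k : Fin n → R)
    (hk : ∀ j, ∑ i, k i * (T.form i j : R) = 0) : ∃ a, T.crossingSum a = k := by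
  obtain ⟨u, hu⟩ := h2
  let f : Fin m × Fin 3 → R := fun d => (u⁻¹ : Rˣ) * (k (T.edge d) + k (T.edge (nextSide d)) -
    k (T.edge (nextSide (nextSide d))))
  have hf1 : ∀ d, f (T.opp (nextSide d)) = f d := by
    intro d
    have h := hk (T.edge (nextSide d))
    rw [sum_mul_form, nextSide_nextSide_nextSide] at h
    simp only [f, edge_opp]
    congr 1
    linear_combination -h
  have hf2 : ∀ d d', T.puncture d = T.puncture d' → f d = f d' := by
    intro d d' h
    rw [T.puncture_eq_iff] at h
    induction h with
    | rel a b h => rw [h, hf1]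
    | refl => rfl
    | symm a b _ ih => exact ih.symm
    | trans a b c _ _ ih ih' => exact ih.trans ih'
  refine ⟨fun v => f (T.puncture_surjective v).choose, ?_⟩
  funext i
  obtain ⟨d, rfl⟩ := T.edge_surjective i
  rw [crossingSum_edge, hf2 _ _ (T.puncture_surjective (T.puncture d)).choose_spec,
    hf2 _ _ (T.puncture_surjective (T.puncture (nextSide (nextSide d)))).choose_spec]
  simp only [f, nextSide_nextSide_nextSide]
  have hu' : ((u⁻¹ : Rˣ) : R) * 2 = 1 := by rw [← hu, Units.inv_mul]
  linear_combination k (T.edge d) * hu'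

/-- A combination of puncture multi-indices that is constant on all faces has equal
coefficients. -/
theorem eq_of_crossingSum_nextSide (h2 : IsUnit (2 : R)) (a : Fin s → R)
    (ha : ∀ d, T.crossingSum a (T.edge (nextSide d)) = T.crossingSum a (T.edge d))
    (v v' : Fin s) : a v = a v' := by
  have h3 : ∀ (t : Fin m) (i : Fin 3),
      T.crossingSum a (T.edge (t, i)) = T.crossingSum a (T.edge (t, 0)) := by
    intro t i
    have h0 := ha (t, 0)
    have h1 := ha (t, 1)
    fin_cases i
    · rfl
    · exact h0
    · exact h1.trans h0
  -- Adjacent faces share an edge, so the constants of the faces propagate over the connected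
  -- surface.
  have h4 : ∀ t t', T.crossingSum a (T.edge (t, 0)) = T.crossingSum a (T.edge (t', 0)) := by
    intro t t'
    induction T.connected t t' with
    | refl => rfl
    | tail _ h ih =>
      obtain ⟨i, j, hij⟩ := h
      rw [ih, ← h3 _ i, ← T.edge_opp, hij, h3]
  obtain ⟨d, rfl⟩ := T.puncture_surjective v
  obtain ⟨d', rfl⟩ := T.puncture_surjective v'
  refine h2.mul_left_cancel ?_
  rw [← crossingSum_corner, ← crossingSum_corner]
  simp only [ha]
  rw [h3 d.1 d.2, h3 d'.1 d'.2, h4 d.1 d'.1]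

/-- Every edge has two ends; this is the source of `∏ P_j = H²`. -/
theorem crossingSum_one (i : Fin n) : T.crossingSum (1 : Fin s → R) i = 2 := by
  obtain ⟨d, rfl⟩ := T.edge_surjective i
  rw [crossingSum_edge]
  exact one_add_one_eq_two

end

/-! ### Sizes of kernels mod `N`, and the number of faces. -/

theorem isUnit_two_zmod {N : ℕ} (hN : Odd N) : IsUnit (2 : ZMod N) := by
  have := (ZMod.isUnit_iff_coprime 2 N).2 hN.coprime_two_left
  exact_mod_cast this

theorem card_form_kernel {N : ℕ} (hN : Odd N) :
    Nat.card {g : Fin n → ZMod N // ∀ j, ∑ i, g i * (T.form i j : ZMod N) = 0} = N ^ s := by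
  have : NeZero N := ⟨hN.pos.ne'⟩
  have h1 : Function.Bijective fun a : Fin s → ZMod N =>
      (⟨T.crossingSum a, T.sum_crossingSum_mul_form a⟩ :
        {g : Fin n → ZMod N // ∀ j, ∑ i, g i * (T.form i j : ZMod N) = 0}) := by
    constructor
    · intro a b hab
      exact T.crossingSum_injective (isUnit_two_zmod hN) (congrArg Subtype.val hab)
    · rintro ⟨g, hg⟩
      obtain ⟨a, ha⟩ := T.exists_crossingSum_eq (isUnit_two_zmod hN) g hg
      exact ⟨a, Subtype.ext ha⟩
  rw [← Nat.card_congr (Equiv.ofBijective _ h1)]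
  simp

theorem three_mul_faces {m n s : ℕ} (T : IdealTriangulation m n s) : 3 * m = 2 * n := by
  have h1 := Finset.card_eq_sum_card_fiberwise (f := T.edge) (s := Finset.univ)
    (t := Finset.univ) fun _ _ => Finset.mem_coe.2 (Finset.mem_univ _)
  have h2 : ∀ e ∈ Finset.univ, (Finset.univ.filter fun d => T.edge d = e).card = 2 := by
    intro e _
    obtain ⟨d, rfl⟩ := T.edge_surjective e
    rw [filter_edge_eq, Finset.card_pair (T.opp_ne d).symm]
  rw [Finset.sum_congr rfl h2] at h1
  simp at h1
  omega

/-- The kernel consists of the constant vectors. Irreducible representations of a triangle algebra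
thus satisfy `dim² · N = N³`. -/
theorem card_kernel_triangleForm {N : ℕ} (hN : Odd N) :
    Nat.card {g : Fin 3 → ZMod N // ∀ j, ∑ i, g i * (triangleForm i j : ZMod N) = 0} = N := by
  have : NeZero N := ⟨hN.pos.ne'⟩
  have h1 : Function.Bijective fun a : ZMod N =>
      (⟨fun _ => a, fun j => by
        fin_cases j <;> simp [Fin.sum_univ_three, triangleForm]⟩ :
        {g : Fin 3 → ZMod N // ∀ j, ∑ i, g i * (triangleForm i j : ZMod N) = 0}) := by
    constructor
    · intro a b hab
      exact congrFun (congrArg Subtype.val hab) 0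
    · rintro ⟨g, hg⟩
      refine ⟨g 0, Subtype.ext ?_⟩
      have h0 := hg 0
      have h1 := hg 1
      have h2 := hg 2
      simp [Fin.sum_univ_three, triangleForm] at h0 h1 h2
      funext i
      fin_cases i
      · rfl
      · simp
        linear_combination -h2
      · simp
        linear_combination h1
  rw [← Nat.card_congr (Equiv.ofBijective _ h1)]
  simp

theorem triangleForm_swap (i j : Fin 3) : triangleForm j i = -triangleForm i j := by
  fin_cases i <;> fin_cases j <;> rfl

end IdealTriangulation

/-! ## Local representations -/

namespace QuantumTorus

variable {n : ℕ} {σ : Fin n → Fin n → ℤ} {q : ℂˣ}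

theorem QComm.map {A B : Type*} [Semiring A] [Algebra ℂ A] [Semiring B] [Algebra ℂ B]
    (φ : A →ₐ[ℂ] B) {u v : Aˣ} {z : ℤ} (h : QComm q u v z) :
    QComm q (Units.map (φ : A →* B) u) (Units.map (φ : A →* B) v) z := by
  unfold QComm at *
  rw [← map_mul, h, map_mul, map_mul, map_qpow]

theorem QComm.mapMonomial_right {B : Type*} [Semiring B] [Algebra ℂ B]
    (φ : QuantumTorus σ q →ₐ[ℂ] B) {u : Bˣ} {z : Fin n → ℤ}
    (h : ∀ i, QComm q u (Units.map (φ : QuantumTorus σ q →* B) (X σ q i)) (z i))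
    (k : Fin n → ℤ) : QComm q u (mapMonomial φ k) (∑ i, k i * z i) := by
  have h1 := (QComm.qpow_right u (-∑ i, ∑ j, if i < j then σ i j * k i * k j else 0)).mul_right
    (QComm.ofFn_right fun i => (h i).zpow_right (k i))
  rw [zero_add] at h1
  unfold mapMonomial monomial
  rw [map_mul, map_qpow, map_list_prod, List.map_ofFn]
  simpa only [Function.comp_def, map_zpow] using h1

theorem QComm.tprod {m : ℕ} {A : Type*} [Semiring A] [Algebra ℂ A] {M M' : Fin m → Aˣ}
    {z : Fin m → ℤ} (h : ∀ t, QComm q (M t) (M' t) (z t)) :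
    QComm q
      (Units.map (PiTensorProduct.tprodMonoidHom ℂ) (MulEquiv.piUnits.symm M) :
        (⨂[ℂ] _t : Fin m, A)ˣ)
      (Units.map (PiTensorProduct.tprodMonoidHom ℂ) (MulEquiv.piUnits.symm M'))
      (∑ t, z t) := by
  have hM : (fun t => (M t : A)) * (fun t => (M' t : A)) =
      fun t => ((q ^ z t : ℂˣ) : ℂ) • ((fun t => (M' t : A)) * fun t => (M t : A)) t := by
    funext t
    have := congrArg Units.val (h t)
    simpa [qpow_val, Algebra.smul_def] using this
  have hq : ∏ t, ((q ^ z t : ℂˣ) : ℂ) = ((q ^ (∑ t, z t) : ℂˣ) : ℂ) := by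
    rw [← Units.coe_prod]
    congr 1
    generalize (Finset.univ : Finset (Fin m)) = S
    induction S using Finset.cons_induction with
    | empty => simp
    | cons a S ha ih => rw [Finset.prod_cons, Finset.sum_cons, zpow_add, ih]
  unfold QComm
  ext
  change PiTensorProduct.tprod ℂ (fun t => (M t : A)) * PiTensorProduct.tprod ℂ (fun t =>
      (M' t : A)) =
    algebraMap ℂ _ ((q ^ (∑ t, z t) : ℂˣ) : ℂ) *
      (PiTensorProduct.tprod ℂ (fun t => (M' t : A)) * PiTensorProduct.tprod ℂ fun t => (M t : A))
  rw [PiTensorProduct.tprod_mul_tprod, PiTensorProduct.tprod_mul_tprod, hM,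
    MultilinearMap.map_smul_univ, hq]
  exact Algebra.smul_def (A := ⨂[ℂ] _t : Fin m, A) _ _

end QuantumTorus

namespace IdealTriangulation

open QuantumTorus

variable {m n s : ℕ} (T : IdealTriangulation m n s) {q : ℂˣ} {N : ℕ}

theorem units_map_embed_X (e : Fin n) :
    Units.map (T.embed q : T.ChekhovFock q →* ⨂[ℂ] _t : Fin m, TriangleAlgebra q)
      (X T.form q e) = T.tensorGen q e := by
  ext
  exact lift_X _ _ e

/-- The generator of a side of a face in the tensor product of the triangle algebras. -/
def sideGen (m : ℕ) (q : ℂˣ) (t : Fin m) (j : Fin 3) : (⨂[ℂ] _t : Fin m, TriangleAlgebra q)ˣ :=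
  Units.map (PiTensorProduct.tprodMonoidHom ℂ)
    (MulEquiv.piUnits.symm (Pi.mulSingle t (X triangleForm q j)))

/-- A generator of a single face acts on a local representation and sees only the exponents on that
face. This is what detects vanishing traces. -/
theorem qcomm_sideGen_tensorGen (t : Fin m) (j : Fin 3) (e : Fin n) :
    QComm q (sideGen m q t j) (T.tensorGen q e)
      (∑ i, T.sideIndex e t i * (2 * triangleForm j i)) := by
  have h : ∀ t', QComm q ((Pi.mulSingle t (X triangleForm q j) : Fin m → (TriangleAlgebra q)ˣ) t')
      (monomial triangleForm q (T.sideIndex e t'))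
      ((Pi.single t (∑ i, T.sideIndex e t i * (2 * triangleForm j i)) : Fin m → ℤ) t') := by
    intro t'
    by_cases ht : t' = t
    · subst ht
      rw [Pi.mulSingle_eq_same, Pi.single_eq_same]
      exact QComm.monomial_right (fun i => X_mul_X j i) _
    · rw [Pi.mulSingle_eq_of_ne ht, Pi.single_eq_of_ne ht]
      simpa using (QComm.one_right (q := q) (monomial triangleForm q (T.sideIndex e t'))).symm
  have h1 := QComm.tprod h
  rwa [Finset.sum_pi_single' t, if_pos (Finset.mem_univ t)] at h1

theorem sum_sideIndex (k : Fin n → ℤ) (t : Fin m) (j : Fin 3) :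
    ∑ e, k e * ∑ i, T.sideIndex e t i * (2 * triangleForm j i) =
      2 * ∑ i, k (T.edge (t, i)) * triangleForm j i := by
  simp only [Finset.mul_sum]
  rw [Finset.sum_comm]
  refine Finset.sum_congr rfl fun i _ => ?_
  simp only [sideIndex, ite_mul, mul_ite, one_mul, zero_mul, mul_zero, Finset.sum_ite_eq,
    Finset.mem_univ, if_true]
  ring

variable {V : Type u} [AddCommGroup V] [Module ℂ V] {ρ : T.ChekhovFock q →ₐ[ℂ] Module.End ℂ V}

theorem IsLocalRep.finiteDimensional (hρ : IsLocalRep.{u, w} T q ρ) : FiniteDimensional ℂ V := by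
  obtain ⟨W, _, _, τ, hτ, L, -⟩ := hρ
  have := fun t => (hτ t).1
  exact Module.Finite.equiv L.symm

theorem IsLocalRep.finrank_eq (hρ : IsLocalRep.{u, w} T q ρ) (hN : Odd N)
    (hq : IsPrimitiveRoot q N) : Module.finrank ℂ V = N ^ m := by
  obtain ⟨W, _, _, τ, hτ, L, -⟩ := hρ
  have : NeZero N := ⟨hN.pos.ne'⟩
  have := fun t => (hτ t).1
  have hW : ∀ t, Module.finrank ℂ (W t) = N := by
    intro t
    have h1 := finrank_sq_mul_card_radical (τ t) triangleForm_swap hN hq (hτ t).2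
    rw [card_kernel_triangleForm hN, pow_succ N 2] at h1
    exact Nat.pow_left_injective (n := 2) two_ne_zero (Nat.eq_of_mul_eq_mul_right hN.pos h1)
  rw [L.finrank_eq,
    Module.finrank_eq_card_basis (Basis.piTensorProduct fun t => Module.finBasis ℂ (W t))]
  simp [hW]

/-- A monomial with nonzero trace in a local representation has equal exponents on the sides of
each face. -/
theorem IsLocalRep.exponent_nextSide (hρ : IsLocalRep.{u, w} T q ρ) (hN : Odd N)
    (hq : IsPrimitiveRoot q N) (k : Fin n → ℤ)
    (hk : LinearMap.trace ℂ V (mapMonomial ρ k : Module.End ℂ V) ≠ 0) (d : Fin m × Fin 3) :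
    (k (T.edge (nextSide d)) : ZMod N) = k (T.edge d) := by
  obtain ⟨W, _, _, τ, hτ, L, hL⟩ := hρ
  have htr : LinearMap.trace ℂ V (mapMonomial ρ k : Module.End ℂ V) =
      LinearMap.trace ℂ (⨂[ℂ] t, W t)
        (mapMonomial ((tensorRep τ).comp (T.embed q)) k : Module.End ℂ (⨂[ℂ] t, W t)) := by
    rw [← LinearMap.trace_conj' _ L]
    congr 1
    refine LinearMap.ext fun v => ?_
    rw [LinearEquiv.conj_apply_apply, mapMonomial_val, mapMonomial_val, hL,
      LinearEquiv.apply_symm_apply]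
  rw [htr] at hk
  -- If one of these sums is nonzero mod `N`, a side generator commutes with the monomial up to a
  -- nontrivial root of unity and its trace vanishes. The three equations say that consecutive
  -- exponents agree.
  have h1 : ∀ j, ∑ i, (k (T.edge (d.1, i)) : ZMod N) * (triangleForm j i : ZMod N) = 0 := by
    intro j
    have h2 : QComm q (Units.map (tensorRep τ : (⨂[ℂ] _t : Fin m, TriangleAlgebra q) →* _)
        (sideGen m q d.1 j)) (mapMonomial ((tensorRep τ).comp (T.embed q)) k)
        (∑ e, k e * ∑ i, T.sideIndex e d.1 i * (2 * triangleForm j i)) := by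
      refine QComm.mapMonomial_right _ (fun e => ?_) k
      have h3 := (T.qcomm_sideGen_tensorGen (q := q) d.1 j e).map (tensorRep τ)
      rw [← units_map_embed_X] at h3
      exact h3
    rw [sum_sideIndex] at h2
    by_contra hne
    refine hk (trace_eq_zero_of_mul_eq_smul_mul _ _ _ ?_ (by
      have h4 := congrArg Units.val h2
      rw [qpow_eq_scalarUnit, scalarUnit_val_mul, Units.val_mul, Units.val_mul] at h4
      exact h4))
    intro h5
    rw [Units.val_eq_one, hq.zpow_eq_one_iff_dvd, ← ZMod.intCast_zmod_eq_zero_iff_dvd] at h5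
    push_cast at h5
    exact hne ((isUnit_two_zmod hN).mul_right_eq_zero.1 h5)
  obtain ⟨t, i⟩ := d
  have h10 := h1 0
  have h11 := h1 1
  have h12 := h1 2
  simp [Fin.sum_univ_three, triangleForm] at h10 h11 h12
  have e2 : (2 : Fin 3) + 1 = 0 := rfl
  have e1 : (1 : Fin 3) + 1 = 2 := rfl
  fin_cases i
  · simp [nextSide]
    linear_combination -h12
  · simp [nextSide, e1]
    linear_combination -h10
  · simp [nextSide, e2]
    linear_combination -h11

end IdealTriangulation

/-! ## The decomposition of local representations -/

theorem smul_one_end_injective (V : Type*) [AddCommGroup V] [Module ℂ V] [Nontrivial V] {z z' : ℂ}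
    (h : z • (1 : Module.End ℂ V) = z' • 1) : z = z' :=
  smul_left_injective ℂ (one_ne_zero : (1 : Module.End ℂ V) ≠ 0) h

theorem sum_fin_pow_of_pow_eq_one {N : ℕ} {z : ℂ} (hz : z ^ N = 1) :
    ∑ a : Fin N, z ^ (a : ℕ) = if z = 1 then (N : ℂ) else 0 := by
  rw [Fin.sum_univ_eq_sum_range fun a => z ^ a]
  split_ifs with h
  · simp [h]
  · have h1 := mul_geom_sum z N
    rw [hz, sub_self] at h1
    exact (mul_eq_zero.1 h1).resolve_left (sub_ne_zero.2 h)

namespace IdealTriangulation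

open QuantumTorus

variable {m n s : ℕ} (T : IdealTriangulation m n s) {q : ℂˣ} {N : ℕ}

theorem puncture_count_pos {m n s : ℕ} (T : IdealTriangulation m n s) : 0 < s :=
  Fin.pos (T.puncture (⟨0, T.faces_pos⟩, 0))

theorem crossingSum_single (j : Fin s) :
    T.crossingSum (Pi.single j 1) = fun i => (T.crossings j i : ℤ) := by
  funext i
  simp [crossingSum, Pi.single_apply]

theorem pairing_crossingSum (a : Fin s → ℤ) (l : Fin n → ℤ) :
    pairing T.form (T.crossingSum a) l = 0 :=
  Finset.sum_eq_zero fun j _ => by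
    have := T.sum_crossingSum_mul_form a j
    simp only [Int.cast_id] at this
    rw [this, mul_zero]

theorem intCast_crossingSum (a : Fin s → ℤ) (i : Fin n) :
    ((T.crossingSum a i : ℤ) : ZMod N) = T.crossingSum (fun v => (a v : ZMod N)) i := by
  simp [crossingSum]

/-! ### Puncture weights and the classification of irreducible representations. -/

section

variable {V : Type*} [AddCommGroup V] [Module ℂ V] (ρ : T.ChekhovFock q →ₐ[ℂ] Module.End ℂ V)
  {x : Fin n → ℂ} {c : ℂ}

/-- Puncture multi-indices pair to zero with everything, so their monomials multiply without phases;
punctures are added one at a time. -/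
theorem mapMonomial_crossingSum (p : Fin s → ℂ)
    (hp : ∀ j, ρ (T.punctureInvariant q j) = p j • 1) (a : Fin s → ℕ) :
    (mapMonomial ρ (T.crossingSum fun v => (a v : ℤ)) : Module.End ℂ V) =
      (∏ v, p v ^ a v) • 1 := by
  have h : ∀ S : Finset (Fin s),
      (mapMonomial ρ (T.crossingSum fun v => if v ∈ S then (a v : ℤ) else 0) : Module.End ℂ V) =
        (∏ v ∈ S, p v ^ a v) • 1 := by
    intro S
    induction S using Finset.induction_on with
    | empty =>
      have : (T.crossingSum fun v => if v ∈ (∅ : Finset (Fin s)) then (a v : ℤ) else 0) = 0 := by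
        funext i
        simp [crossingSum]
      rw [this, mapMonomial, monomial_zero, map_one]
      simp
    | insert j S hj ih =>
      have h1 : (T.crossingSum fun v => if v ∈ insert j S then (a v : ℤ) else 0) =
          T.crossingSum (fun v => if v ∈ S then (a v : ℤ) else 0) +
            (a j : ℤ) • T.crossingSum (Pi.single j 1) := by
        funext i
        simp only [crossingSum, Pi.add_apply, Pi.smul_apply, smul_eq_mul, Finset.mul_sum,
          ← Finset.sum_add_distrib]
        refine Finset.sum_congr rfl fun v _ => ?_
        by_cases hv : v = j
        · subst hv
          simp [hj]
        · simp [hv]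
      have h2 := mapMonomial_mul ρ T.form_swap
        (T.crossingSum fun v => if v ∈ S then (a v : ℤ) else 0)
        ((a j : ℤ) • T.crossingSum (Pi.single j 1))
      rw [pairing_crossingSum, zpow_zero, map_one, one_mul, ← h1] at h2
      have h3 : (mapMonomial ρ ((a j : ℤ) • T.crossingSum (Pi.single j 1)) : Module.End ℂ V) =
          p j ^ a j • 1 := by
        rw [mapMonomial, ← monomial_pow T.form_swap, map_pow, Units.val_pow_eq_pow_val,
          ← mapMonomial, crossingSum_single]
        have := hp j
        unfold punctureInvariant at this
        rw [mapMonomial_val, this, smul_pow, one_pow]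
      rw [← h2, Units.val_mul, ih, h3, Finset.prod_insert hj, smul_mul_smul_comm, mul_one, mul_comm]
  simpa using h Finset.univ

theorem mapMonomial_const (hc : ρ (T.H q) = c • 1) (a : ℕ) :
    (mapMonomial ρ (T.crossingSum fun _ => (a : ℤ)) : Module.End ℂ V) = (c ^ 2) ^ a • 1 := by
  have h1 : (T.crossingSum fun _ => (a : ℤ)) = ((2 * a : ℕ) : ℤ) • fun _ => (1 : ℤ) := by
    funext i
    have h2 := T.crossingSum_one (R := ℤ) i
    simp only [crossingSum, Pi.one_apply, one_mul] at h2
    simp only [crossingSum, ← Finset.mul_sum, h2, Pi.smul_apply, smul_eq_mul]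
    push_cast
    ring
  unfold H at hc
  rw [h1, mapMonomial, ← monomial_pow T.form_swap, map_pow, Units.val_pow_eq_pow_val,
    ← mapMonomial, mapMonomial_val, hc, smul_pow, one_pow, pow_mul]

variable {T ρ}

theorem HasWeights.units (h : T.HasWeights q N ρ x c) (i : Fin n) :
    ρ ((X T.form q i : T.ChekhovFock q) ^ N) =
      algebraMap ℂ _ ((Units.mk0 (x i) (h.weight_ne_zero i) : ℂˣ) : ℂ) := by
  rw [h.edge_eq, Units.val_mk0, Algebra.algebraMap_eq_smul_one]

theorem HasWeights.subRep (h : T.HasWeights q N ρ x c) (U : Submodule ℂ V)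
    (hU : ∀ a, ∀ u ∈ U, ρ a u ∈ U) : T.HasWeights q N (subRep ρ U hU) x c where
  weight_ne_zero := h.weight_ne_zero
  charge_pow := h.charge_pow
  edge_eq i := subRep_eq_smul_one ρ U hU (h.edge_eq i)
  charge_eq := subRep_eq_smul_one ρ U hU h.charge_eq

/-- Both conditions are monomial identities: `P_j ^ N` has multi-index in `N ℤ^n`, and the product
of all `P_j` is `H²`. -/
theorem HasWeights.admissible [Nontrivial V] (hq : q ^ N = 1) (h : T.HasWeights q N ρ x c)
    {p : Fin s → ℂ} (hp : ∀ j, ρ (T.punctureInvariant q j) = p j • 1) :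
    T.AdmissiblePunctureWeights N x c p := by
  constructor
  · intro j
    have h1 := mapMonomial_smul ρ hq h.units fun i => (T.crossings j i : ℤ)
    rw [mapMonomial, ← monomial_pow T.form_swap, map_pow] at h1
    have h2 := congrArg Units.val h1
    have h3 := hp j
    unfold punctureInvariant at h3
    rw [Units.val_pow_eq_pow_val, scalarUnit_val, Algebra.algebraMap_eq_smul_one, ← mapMonomial,
      mapMonomial_val, h3, smul_pow, one_pow] at h2
    rw [smul_one_end_injective V h2]
    simp
  · have h1 := T.mapMonomial_crossingSum ρ p hp fun _ => 1
    have h2 := T.mapMonomial_const ρ h.charge_eq 1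
    rw [h1] at h2
    have h3 := smul_one_end_injective V h2
    simpa using h3.symm

theorem exists_puncture_weights [FiniteDimensional ℂ V] (hρ : IsIrreducibleRep ρ) :
    ∃ p : Fin s → ℂ, ∀ j, ρ (T.punctureInvariant q j) = p j • 1 := by
  have hirr : IsIrreducibleFamily fun k => (mapMonomial ρ k : Module.End ℂ V) :=
    ⟨hρ.1, fun U hU => hρ.2 U (apply_mem_of_mapMonomial_mem ρ U hU)⟩
  have h1 : ∀ j, ∃ z : ℂ, ρ (T.punctureInvariant q j) = z • 1 := by
    intro j
    refine hirr.exists_eq_smul_one _ fun k => ?_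
    have h2 := mapMonomial_mul ρ T.form_swap k (T.crossingSum (Pi.single j 1))
    have h3 := mapMonomial_mul ρ T.form_swap (T.crossingSum (Pi.single j 1)) k
    rw [pairing_swap T.form_swap (T.crossingSum (Pi.single j 1)), pairing_crossingSum,
      neg_zero] at h2
    rw [pairing_crossingSum, add_comm, ← h2, crossingSum_single] at h3
    exact (congrArg Units.val h3).symm
  exact ⟨fun j => (h1 j).choose, fun j => (h1 j).choose_spec⟩

/-- Irreducible representations with the same weights are isomorphic. -/
theorem repIso_of_weights {V' : Type*} [AddCommGroup V'] [Module ℂ V']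
    {ρ' : T.ChekhovFock q →ₐ[ℂ] Module.End ℂ V'} [FiniteDimensional ℂ V] [FiniteDimensional ℂ V']
    (hN : Odd N) (hq : IsPrimitiveRoot q N) (hρ : IsIrreducibleRep ρ) (hρ' : IsIrreducibleRep ρ')
    (h : T.HasWeights q N ρ x c) (h' : T.HasWeights q N ρ' x c) {p : Fin s → ℂ}
    (hp : ∀ j, ρ (T.punctureInvariant q j) = p j • 1)
    (hp' : ∀ j, ρ' (T.punctureInvariant q j) = p j • 1) : RepIso ρ ρ' := by
  have : NeZero N := ⟨hN.pos.ne'⟩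
  obtain ⟨L, hL⟩ := (isProjectiveRep_residueOp (N := N) ρ T.form_swap hq.pow_eq_one
    h.units).exists_linearEquiv
    (isProjectiveRep_residueOp (N := N) ρ' T.form_swap hq.pow_eq_one h'.units)
    (isIrreducibleFamily_residueOp ρ T.form_swap hq.pow_eq_one h.units hρ)
    (isIrreducibleFamily_residueOp ρ' T.form_swap hq.pow_eq_one h'.units hρ') (by
      -- A radical element is, mod `N`, a combination of puncture multi-indices, so its operator is
      -- a scalar computed from `x` and `p` alone, the same on both sides.
      intro g hg
      rw [mem_radical_multiplier_iff T.form_swap hN hq] at hg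
      obtain ⟨a, ha⟩ := T.exists_crossingSum_eq (isUnit_two_zmod hN) g hg
      have h1 := exists_eq_add_smul (N := N) (residueLift g)
        (T.crossingSum fun v => (((a v).val : ℕ) : ℤ)) fun i => by
          rw [intCast_residueLift, intCast_crossingSum]
          simp [ha]
      unfold residueOp
      rw [h1, mapMonomial_add_smul ρ T.form_swap hq.pow_eq_one h.units,
        mapMonomial_add_smul ρ' T.form_swap hq.pow_eq_one h'.units, scalarUnit_val_mul,
        scalarUnit_val_mul, mapMonomial_crossingSum T ρ p hp,
        mapMonomial_crossingSum T ρ' p hp', smul_smul, smul_smul]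
      exact ⟨_, rfl, rfl⟩)
  exact repIso_of_residueOp ρ ρ' T.form_swap hq.pow_eq_one h.units h'.units L hL

theorem AdmissiblePunctureWeights.ne_zero {p : Fin s → ℂ} (hN : Odd N)
    (hp : T.AdmissiblePunctureWeights N x c p) (hx : ∀ i, x i ≠ 0) (j : Fin s) : p j ≠ 0 := by
  intro h
  have h1 := hp.1 j
  rw [h, zero_pow hN.pos.ne'] at h1
  exact Finset.prod_ne_zero_iff.2 (fun i _ => pow_ne_zero _ (hx i)) h1.symm

theorem finrank_irreducible [FiniteDimensional ℂ V] {g : ℕ} (hg : 0 < g) (hT : T.HasGenus g)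
    (hN : Odd N) (hq : IsPrimitiveRoot q N) (hρ : IsIrreducibleRep ρ) :
    Module.finrank ℂ V = N ^ (s + 3 * g - 3) := by
  have : NeZero N := ⟨hN.pos.ne'⟩
  have h1 := finrank_sq_mul_card_radical ρ T.form_swap hN hq hρ
  have h2 := T.three_mul_faces
  -- From `3 m = 2 n` and the Euler characteristic, `n = 3 s + 6 g - 6`; `g > 0` keeps the
  -- natural-number subtraction exact.
  have h3 : n = (s + 3 * g - 3) * 2 + s := by
    unfold HasGenus at hT
    omega
  rw [card_form_kernel T hN, h3, pow_add, pow_mul] at h1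
  exact Nat.pow_left_injective (n := 2) two_ne_zero
    (Nat.eq_of_mul_eq_mul_right (pow_pos hN.pos s) h1)

end

/-! ### Traces in local representations and multiplicities. -/

variable {V : Type u} [AddCommGroup V] [Module ℂ V] {ρ : T.ChekhovFock q →ₐ[ℂ] Module.End ℂ V}
  {x : Fin n → ℂ} {c : ℂ}

/-- The sum of the traces of the products of powers of the puncture invariants against a character
of the puncture weights, for a local representation. -/
theorem IsLocalRep.sum_trace (hρ : IsLocalRep.{u, w} T q ρ) (hN : Odd N)
    (hq : IsPrimitiveRoot q N) (h : T.HasWeights q N ρ x c) {p : Fin s → ℂ}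
    (hp : T.AdmissiblePunctureWeights N x c p) :
    ∑ a : Fin s → Fin N, (∏ v, (p v)⁻¹ ^ (a v : ℕ)) * LinearMap.trace ℂ V
      (mapMonomial ρ (T.crossingSum fun v => ((a v : ℕ) : ℤ)) : Module.End ℂ V) =
        (N : ℂ) * (N : ℂ) ^ m := by
  have : FiniteDimensional ℂ V := hρ.finiteDimensional
  have hs : Nonempty (Fin s) := ⟨⟨0, T.puncture_count_pos⟩⟩
  have hinj : Function.Injective fun (b : Fin N) (_ : Fin s) => b :=
    fun b b' hb => congrFun hb (Classical.arbitrary _)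
  -- Reduce to constant `a`: each of these `N` terms equals `N ^ m`, as `∏ p_v = c²` cancels the
  -- scalar of `H²`.
  rw [← Finset.sum_subset (Finset.subset_univ (Finset.univ.map ⟨_, hinj⟩)), Finset.sum_map]
  · have h1 : ∀ b : Fin N, (∏ v : Fin s, (p v)⁻¹ ^ (b : ℕ)) * LinearMap.trace ℂ V
        (mapMonomial ρ (T.crossingSum fun _ => ((b : ℕ) : ℤ)) : Module.End ℂ V) =
          (N : ℂ) ^ m := by
      intro b
      have hc : c ^ 2 ≠ 0 := by
        rw [hp.2]
        exact Finset.prod_ne_zero_iff.2 fun j _ => hp.ne_zero hN h.weight_ne_zero j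
      rw [T.mapMonomial_const ρ h.charge_eq, map_smul, LinearMap.trace_one, hρ.finrank_eq T hN hq,
        Finset.prod_pow, Finset.prod_inv_distrib, ← hp.2, smul_eq_mul, ← mul_assoc, ← mul_pow,
        inv_mul_cancel₀ hc, one_pow, one_mul, Nat.cast_pow]
    simp only [Function.Embedding.coeFn_mk]
    rw [Finset.sum_congr rfl fun b _ => h1 b]
    simp
  · intro a _ ha
    by_contra hne
    have h1 := right_ne_zero_of_mul hne
    refine ha (Finset.mem_map.2 ⟨a (Classical.arbitrary _), Finset.mem_univ _, ?_⟩)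
    funext v
    -- A nonzero trace forces the residues of all `a v` to agree; as `a v < N`, the numbers
    -- themselves agree.
    have h2 := T.eq_of_crossingSum_nextSide (isUnit_two_zmod hN) (fun v => ((a v : ℕ) : ZMod N))
      (fun d => by
        have h3 := hρ.exponent_nextSide T hN hq _ h1 d
        simpa [intCast_crossingSum] using h3) (Classical.arbitrary _) v
    rw [ZMod.natCast_eq_natCast_iff', Nat.mod_eq_of_lt (Fin.is_lt _),
      Nat.mod_eq_of_lt (Fin.is_lt _)] at h2
    exact Fin.ext h2

end IdealTriangulation

end

theorem theorem1 {m n s : ℕ} (T : IdealTriangulation m n s) (g : ℕ) (hg : 0 < g)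
    (hT : T.HasGenus g) (N : ℕ) (hN : Odd N) (q : ℂˣ) (hq : IsPrimitiveRoot q N)
    {V : Type u} [AddCommGroup V] [Module ℂ V]
    (ρ : T.ChekhovFock q →ₐ[ℂ] Module.End ℂ V)
    (hρ : IdealTriangulation.IsLocalRep.{u, w} T q ρ)
    (x : Fin n → ℂ) (c : ℂ) (hxc : T.HasWeights q N ρ x c) :
    ∃ (r : ℕ) (U : Fin r → Submodule ℂ V)
      (hU : ∀ i, ∀ a : T.ChekhovFock q, ∀ u ∈ U i, ρ a u ∈ U i) (p : Fin r → Fin s → ℂ),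
      DirectSum.IsInternal U ∧
      (∀ i, T.IsIrreducibleWithWeights q N (subRep ρ (U i) (hU i)) x c (p i)) ∧
      (∀ i i', p i = p i' → RepIso (subRep ρ (U i) (hU i)) (subRep ρ (U i') (hU i'))) ∧
      ∀ p₀ : Fin s → ℂ, T.AdmissiblePunctureWeights N x c p₀ →
        Nat.card {i : Fin r // p i = p₀} = N ^ g := by
  classical
  have : NeZero N := ⟨hN.pos.ne'⟩
  have : FiniteDimensional ℂ V := hρ.finiteDimensional
  obtain ⟨r, U, hU, hint, hirr⟩ :=
    QuantumTorus.exists_isInternal_irreducible (N := N) ρ T.form_swap hq.pow_eq_one hxc.units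
  choose p hp using fun i => IdealTriangulation.exists_puncture_weights (hirr i)
  have hw := fun i => hxc.subRep (U i) (hU i)
  have hadm : ∀ i, T.AdmissiblePunctureWeights N x c (p i) := fun i =>
    have := (hirr i).1
    (hw i).admissible hq.pow_eq_one (hp i)
  refine ⟨r, U, hU, p, hint, fun i => ⟨hirr i, hw i, hadm i, hp i⟩, ?_, ?_⟩
  · intro i i' hii
    exact IdealTriangulation.repIso_of_weights hN hq (hirr i) (hirr i') (hw i) (hw i') (hp i) (hii ▸ hp i')
  · intro p₀ hp₀
    have hp₀0 := hp₀.ne_zero hN hxc.weight_ne_zero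
    -- Taken over the components, the trace is a sum of characters of `p i`, each weighted by the
    -- common dimension.
    have htr : ∀ a : Fin s → ℕ, LinearMap.trace ℂ V
        (QuantumTorus.mapMonomial ρ (T.crossingSum fun v => (a v : ℤ)) : Module.End ℂ V) =
          ∑ i, (N : ℂ) ^ (s + 3 * g - 3) * ∏ v, p i v ^ a v := by
      intro a
      rw [QuantumTorus.mapMonomial_val, LinearMap.trace_eq_sum_trace_restrict hint fun i u hu => hU i _ u hu]
      refine Finset.sum_congr rfl fun i _ => ?_
      have h1 := T.mapMonomial_crossingSum (subRep ρ (U i) (hU i)) (p i) (hp i) a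
      have h2 := congrArg (LinearMap.trace ℂ (U i)) h1
      rw [map_smul, LinearMap.trace_one, IdealTriangulation.finrank_irreducible hg hT hN hq (hirr i), smul_eq_mul,
        mul_comm, Nat.cast_pow] at h2
      exact h2
    have hsum := hρ.sum_trace T hN hq hxc hp₀
    -- Orthogonality of characters: each ratio `p i v / p₀ v` is an `N`-th root of unity, and the
    -- sum factors over the punctures into geometric sums.
    have hterm : ∀ i, ∑ a : Fin s → Fin N,
        (∏ v, (p₀ v)⁻¹ ^ (a v : ℕ)) * ∏ v, p i v ^ (a v : ℕ) =
          if p i = p₀ then (N : ℂ) ^ s else 0 := by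
      intro i
      have h1 : ∀ v, ((p₀ v)⁻¹ * p i v) ^ N = 1 := by
        intro v
        rw [mul_pow, inv_pow, hp₀.1, (hadm i).1, ← hp₀.1]
        exact inv_mul_cancel₀ (pow_ne_zero _ (hp₀0 v))
      simp only [← Finset.prod_mul_distrib, ← mul_pow]
      have h2 := Finset.prod_univ_sum (fun _ : Fin s => (Finset.univ : Finset (Fin N)))
        fun v a => ((p₀ v)⁻¹ * p i v) ^ (a : ℕ)
      rw [Fintype.piFinset_univ] at h2
      rw [← h2, Finset.prod_congr rfl fun v _ => sum_fin_pow_of_pow_eq_one (h1 v)]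
      split_ifs with h3
      · rw [h3]
        simp [hp₀0]
      · obtain ⟨v, hv⟩ := Function.ne_iff.1 h3
        refine Finset.prod_eq_zero (Finset.mem_univ v) (if_neg fun h4 => hv ?_)
        rw [inv_mul_eq_one₀ (hp₀0 v)] at h4
        exact h4.symm
    simp only [htr, Finset.mul_sum] at hsum
    rw [Finset.sum_comm] at hsum
    simp only [mul_left_comm _ ((N : ℂ) ^ (s + 3 * g - 3)), ← Finset.mul_sum, hterm] at hsum
    rw [← Finset.sum_filter, Finset.sum_const, nsmul_eq_mul, ← Fintype.card_subtype,
      ← Nat.card_eq_fintype_card] at hsum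
    have h5 : N ^ (s + 3 * g - 3) * (Nat.card {i : Fin r // p i = p₀} * N ^ s) = N * N ^ m := by
      exact_mod_cast hsum
    have h6 := T.three_mul_faces
    have h7 := T.puncture_count_pos
    -- Here `m = 2 s + 4 g - 4`; what remains of `N ^ (m + 1)` after the dimension `N ^ (s + 3 g -
    -- 3)` and the Fourier factor `N ^ s` is `N ^ g`.
    have h8 : m + 1 = (s + 3 * g - 3) + s + g := by
      unfold IdealTriangulation.HasGenus at hT
      omega
    rw [← pow_succ', h8, pow_add, pow_add] at h5
    refine Nat.eq_of_mul_eq_mul_left (pow_pos hN.pos (s + 3 * g - 3 + s)) ?_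
    rw [pow_add, ← h5]
    ring
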